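/- **Model.** A nondeterministic Turing machine (NTM) has finitely many two-way infinite tapes, a finite alphabet and, in every situation, a finite list of available actions; it halts when no action is available. It is *binary* if at most two actions are ever available, so that every nondeterministic step is a choice between exactly two alternatives. It is a polynomial-time NTM (NPTM) if for some polynomial $p$ all its computations on input $x$ have at most $p(|x|)$ steps. TotP is the class of functions $f:\{0,1\}^*\to\mathbb N$ for which there is an NPTM whose number of (all) computation paths on each input $x$ is $f(x)+1$. A randomized algorithm is a binary multi-tape Turing machine in which each choice is made by a fair coin; its output is a rational number, written as a binary numerator and denominator. **Theorem.** Let $f\in\mathrm{TotP}$, and let $M_f$ be a binary NPTM whose number of computation paths on each input $x$ is $f(x)+1$. Let $n'=n'(x)$ be the number of nondeterministic bits used by $M_f$ on input $x$, i.e. the maximal number of nondeterministic steps on a computation of $M_f$ on $x$. For $\xi,\delta>0$ put $k=\lceil 1/\xi\rceil$ and $d=\max(0,\lceil\log_2(1/\delta)\rceil)$. 1. There are a randomized algorithm $A$ and a polynomial $q$ such that for all $x\in\{0,1\}^*$, $n=|x|$, and all real $\xi,\delta>0$: on input $x$, $k$, $d$ ($k$ and $d$ in unary) $A$ always halts within $k^2\cdot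 q(n+d)$ steps, and with probability at least $1-\delta$ it outputs a number $\hat f(x)$ with $$|\hat f(x)-f(x)|\le \xi\cdot 2^{n'(x)} .$$ 2. There are a randomized algorithm $B$ and a polynomial $q$ such that for all $x\in\{0,1\}^*$, $n=|x|$, all natural numbers $m\ge n'(x)$ and all real $\xi,\delta>0$: on input $x$, $k$, $d$, $m$ ($k$, $d$ and $m$ in unary) $B$ always halts within $k^2\cdot q(n+d+m)$ steps, and with probability at least $1-\delta$ it outputs a number $\hat p$ with $$\Bigl|\hat p-\frac{f(x)}{2^{m}}\Bigr|\le \xi .$$ In particular, with $m=n'(x)$ (which is at most polynomial in $n$), $p=f(x)/2^{n'(x)}$ is estimated within additive error $\xi$. -/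

import Mathlib

/-- The three possible movements of a tape head. -/
inductive HeadMove where
  | left
  | stay
  | right

/-- The displacement of the head caused by a movement. -/
def HeadMove.shift : HeadMove → ℤ
  | .left => -1
  | .stay => 0
  | .right => 1

/-- A nondeterministic multi-tape Turing machine with `a` input tapes, `b` output tapes and finitely
many work tapes (all of them two-way infinite, readable and writable). A cell contains `none`
(the blank) or a symbol of a finite alphabet, which contains the two bits.
`trans q s` lists the actions available in state `q` when the heads read the symbols `s`; an action
consists of a new state and, for every tape, a symbol to be written and a head movement. The machine
halts when no action is available. -/
structure NTM (a b : ℕ) where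
  Work : Type
  State : Type
  Symb : Type
  finite_work : Finite Work
  finite_state : Finite State
  finite_symb : Finite Symb
  bit : Bool ↪ Symb
  start : State
  trans : State → (Fin a ⊕ Fin b ⊕ Work → Option Symb) →
    List (State × (Fin a ⊕ Fin b ⊕ Work → Option Symb × HeadMove))

namespace NTM

variable {a b : ℕ}

/-- The index type of the tapes: input tapes, output tapes, work tapes. -/
abbrev TapeIdx (M : NTM a b) : Type := Fin a ⊕ Fin b ⊕ M.Work

/-- An action: new state and, for each tape, the symbol to write and the head movement. -/
abbrev Action (M : NTM a b) : Type := M.State × (M.TapeIdx → Option M.Symb × HeadMove)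

/-- Configurations: state, head positions, tape contents. -/
structure Cfg (M : NTM a b) where
  state : M.State
  head : M.TapeIdx → ℤ
  cells : M.TapeIdx → ℤ → Option M.Symb

/-- The bit string `w` written on the cells `0, …, |w| - 1` of an otherwise blank tape. -/
def writeWord (M : NTM a b) (w : List Bool) (z : ℤ) : Option M.Symb :=
  if 0 ≤ z then (w[z.toNat]?).map M.bit else none

/-- Initial configuration: the `i`-th input is on the `i`-th input tape, everything else is blank,
all heads are on cell `0`. -/
def init (M : NTM a b) (inp : Fin a → List Bool) : M.Cfg where
  state := M.start
  head := fun _ => 0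
  cells := Sum.elim (fun i => M.writeWord (inp i)) (fun _ _ => none)

/-- Performing an action: write, then move, on every tape. -/
def perform (M : NTM a b) (c : M.Cfg) (act : M.Action) : M.Cfg where
  state := act.1
  head := fun i => c.head i + (act.2 i).2.shift
  cells := fun i => Function.update (c.cells i) (c.head i) (act.2 i).1

/-- The list of alternatives for the configuration following `c`. -/
def succs (M : NTM a b) (c : M.Cfg) : List M.Cfg :=
  (M.trans c.state (fun i => c.cells i (c.head i))).map (M.perform c)

/-- A configuration is halting if it has no successor. -/
def Halted (M : NTM a b) (c : M.Cfg) : Prop := M.succs c = []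

/-- `M.Run c w k c'`: starting at `c` and choosing successively the alternatives with the indices
listed in `w` (one index for every step), the machine reaches `c'`, and exactly `k` of
these steps were nondeterministic, i.e. offered at least two alternatives. -/
inductive Run (M : NTM a b) : M.Cfg → List ℕ → ℕ → M.Cfg → Prop
  | refl (c : M.Cfg) : Run M c [] 0 c
  | step {c c' c'' : M.Cfg} {i : ℕ} {w : List ℕ} {k : ℕ}
      (h : (M.succs c)[i]? = some c') (hr : Run M c' w k c'') :
      Run M c (i :: w) (k + if 2 ≤ (M.succs c).length then 1 else 0) c''

/-- On input `inp`, every computation of `M` (whatever the choices) has at most `t` steps. -/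
def HaltsWithin (M : NTM a b) (inp : Fin a → List Bool) (t : ℕ) : Prop :=
  ∀ w k c, M.Run (M.init inp) w k c → w.length ≤ t

/-- The number of all (complete) computation paths of `M` on input `inp`. -/
noncomputable def numPaths (M : NTM a b) (inp : Fin a → List Bool) : ℕ :=
  Set.ncard {w : List ℕ | ∃ k c, M.Run (M.init inp) w k c ∧ M.Halted c}

/-- The maximal number of nondeterministic steps on a computation of `M` on input `inp`. If `M` is
binary this is the number of nondeterministic bits used, i.e. the height of the tree of its
branchings. -/
noncomputable def ndBits (M : NTM a b) (inp : Fin a → List Bool) : ℕ :=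
  sSup {k : ℕ | ∃ w c, M.Run (M.init inp) w k c}

/-- Every nondeterministic step offers exactly two alternatives. -/
def IsBinary (M : NTM a b) : Prop := ∀ q s, (M.trans q s).length ≤ 2

/-- `M` is a nondeterministic polynomial-time Turing machine, with one input. -/
def IsPolyTime (M : NTM 1 b) : Prop :=
  ∃ p : Polynomial ℕ, ∀ x : List Bool, M.HaltsWithin ![x] (p.eval x.length)

/-- `M` is a nondeterministic polynomial-time Turing machine, and the number of all its computation
paths on input `x` is `f x + 1`, for every `x`. -/
def TotComputes (M : NTM 1 0) (f : List Bool → ℕ) : Prop :=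
  M.IsPolyTime ∧ ∀ x : List Bool, M.numPaths ![x] = f x + 1

/-- A binary machine as a randomized machine: the distribution of the configuration reached
from `c` after `t` steps, when each nondeterministic step is decided by a fair coin (halting
configurations are kept). -/
noncomputable def dist (M : NTM a b) : ℕ → M.Cfg → PMF M.Cfg
  | 0, c => PMF.pure c
  | t + 1, c =>
    match M.succs c with
    | [] => PMF.pure c
    | [c'] => M.dist t c'
    | c₀ :: c₁ :: _ => (PMF.uniformOfFintype Bool).bind fun e => M.dist t (if e then c₁ else c₀)

/-- The tape contents `z` show the bit string `w`: it starts at cell `0` and is ended by a blank. -/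
def ShowsWord (M : NTM a b) (z : ℤ → Option M.Symb) (w : List Bool) : Prop :=
  (∀ (j : ℕ) (h : j < w.length), z j = some (M.bit w[j])) ∧ z w.length = none

/-- The natural number with given binary digits, least significant digit first. -/
def binVal (w : List Bool) : ℕ := Nat.ofDigits 2 (w.map Bool.toNat)

/-- The halting configuration `c` shows the rational number `r` as its output: numerator and
denominator (not necessarily coprime) are written in binary on the two output tapes. -/
def Outputs (M : NTM a 2) (c : M.Cfg) (r : ℚ) : Prop :=
  M.Halted c ∧ ∃ u v : List Bool,
    M.ShowsWord (c.cells (Sum.inr (Sum.inl 0))) u ∧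
    M.ShowsWord (c.cells (Sum.inr (Sum.inl 1))) v ∧
    binVal v ≠ 0 ∧ r = (binVal u : ℚ) / (binVal v : ℚ)

/-- The randomized machine `M` on input `inp` always halts within `t` steps, and with probability at
least `1 - δ` its output is a rational number at distance at most `err` from `target`. -/
def Estimates (M : NTM a 2) (inp : Fin a → List Bool) (t : ℕ) (target err δ : ℝ) : Prop :=
  M.HaltsWithin inp t ∧
    ENNReal.ofReal (1 - δ) ≤ (M.dist t (M.init inp)).toOuterMeasure
      {c | ∃ r : ℚ, M.Outputs c r ∧ |(r : ℝ) - target| ≤ err}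

end NTM

/-- The class of functions `f` for which some nondeterministic polynomial-time Turing machine has
exactly `f x + 1` computation paths on each input `x`. -/
def TotP : Set (List Bool → ℕ) := {f | ∃ M : NTM 1 0, M.TotComputes f}

/-- The unary notation of a natural number. -/
def unary (n : ℕ) : List Bool := List.replicate n true

/-!
Let `D` be the number of nondeterministic steps on a computation of the binary machine `M` on `x`
in which every nondeterministic step is decided by a fair coin. A computation path with `D`
nondeterministic steps is taken with probability `2⁻ᴰ`, so the mean of `2 ^ D` is the number of
computation paths (`tsum_branchings`), and the mean of the sample `2 ^ D - 1` is `f x`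
(`integral_sample`). The samples lie between `0` and `2 ^ n'`, where `n'` is the number of
nondeterministic bits. Hence, by Hoeffding's inequality, the average of `k ^ 2 * (1 + d)`
independent samples differs from `f x` by more than `ξ * 2 ^ n'` with probability at most
`2 * exp (-2 * (1 + d)) ≤ 2 ^ (-d) ≤ δ` (`accuracy`). The number `n'`, which cannot be expected to
be computable in polynomial time, is not needed for this. Division by `2 ^ m` gives the estimate of
`f x / 2 ^ m`; so both parts of the theorem are about the same algorithm, with `m = 0` in the first
part.

The algorithm keeps the sum of the samples as the numerator and `2 ^ m` times the number of samples
as the denominator of its result. Since `2 ^ D - 1` has the binary digits `1, …, 1`, and the depth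
`D` is available in unary after a simulation of `M`, a sample is added in one pass over the
numerator. The propagation of carries may take a time that grows with `log k`, which would spoil a
running time of the form `k ^ 2 * q (n + d)`; but this time is paid for by digits `1` that turn into
`0`, so that the amortized cost of a round does not depend on `k` (`count_sumOnes`, `wp_round`).

The machine is put together from program fragments (`Prog`) by sequential composition and loops. Its
behaviour is described by a predicate `Prog.Wp` in continuation-passing style, which takes into
account the time budget and the distribution of the result; `Prog.Wp.toNTM` translates what has
been shown about a program into a statement about the Turing machine that executes it.
-/

namespace TotPSampling

/-! ### Tapes and programs -/

/-- A two-way infinite tape together with the position of its head. -/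
@[ext] structure Tape (Γ : Type) where
  pos : ℤ
  cell : ℤ → Option Γ

namespace Tape

variable {Γ : Type}

/-- The symbol under the head. -/
def read (t : Tape Γ) : Option Γ := t.cell t.pos

/-- Write a symbol, then move the head. -/
def act (t : Tape Γ) (a : Option Γ × HeadMove) : Tape Γ :=
  ⟨t.pos + a.2.shift, Function.update t.cell t.pos a.1⟩

/-- The tape with head on cell `h`, on which `r` is written from cell `h` on to the right and `l`
from cell `h - 1` on to the left; all other cells are blank. -/
def zip (h : ℤ) (l r : List (Option Γ)) : Tape Γ :=
  ⟨h, fun z => if h ≤ z then (r[(z - h).toNat]?).join else (l[(h - 1 - z).toNat]?).join⟩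

/-- A tape without symbols. -/
def Blank (t : Tape Γ) : Prop := ∃ h, t = zip h [] []

variable (h : ℤ) (l r : List (Option Γ)) (a b : Option Γ)

@[simp] theorem read_zip_cons : (zip h l (a :: r)).read = a := by simp [zip, read]

@[simp] theorem read_zip_nil : (zip h l []).read = none := by simp [zip, read]

@[simp] theorem act_read (t : Tape Γ) : t.act (t.read, .stay) = t := by
  ext <;> simp [act, read, HeadMove.shift]

omit h r in
theorem join_getElem?_append_none (n : ℕ) : ((l ++ [none])[n]?).join = (l[n]?).join := by
  grind

theorem zip_append_none_right : zip h l (r ++ [none]) = zip h l r := by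
  simp only [zip, mk.injEq, true_and]
  funext z
  split_ifs
  · exact join_getElem?_append_none r _
  · rfl

theorem zip_append_none_left : zip h (l ++ [none]) r = zip h l r := by
  simp only [zip, mk.injEq, true_and]
  funext z
  split_ifs
  · rfl
  · exact join_getElem?_append_none l _

theorem act_stay : (zip h l (a :: r)).act (b, .stay) = zip h l (b :: r) := by
  simp only [zip, act, HeadMove.shift, add_zero, mk.injEq, true_and]
  funext z
  rcases lt_trichotomy z h with hz | rfl | hz
  · simp [Function.update, hz.ne, not_le.2 hz]
  · simp
  · obtain ⟨n, rfl⟩ : ∃ n : ℕ, z = h + n + 1 := ⟨(z - h - 1).toNat, by omega⟩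
    have : (h + n + 1 - h).toNat = n + 1 := by omega
    simp [Function.update, hz.ne', hz.le, this]

theorem act_right : (zip h l (a :: r)).act (b, .right) = zip (h + 1) (b :: l) r := by
  simp only [zip, act, HeadMove.shift, mk.injEq, true_and]
  funext z
  rcases lt_trichotomy z h with hz | rfl | hz
  · obtain ⟨n, rfl⟩ : ∃ n : ℕ, z = h - n - 1 := ⟨(h - z - 1).toNat, by omega⟩
    have h1 : (h + 1 - 1 - (h - n - 1)).toNat = n + 1 := by omega
    have h2 : (h - 1 - (h - n - 1)).toNat = n := by omega
    have h3 : ¬ h + 1 ≤ h - n - 1 := by omega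
    simp only [Function.update, hz.ne, not_le.2 hz, h1, h2, h3]
    simp
  · simp
  · obtain ⟨n, rfl⟩ : ∃ n : ℕ, z = h + n + 1 := ⟨(z - h - 1).toNat, by omega⟩
    have h1 : (h + n + 1 - h).toNat = n + 1 := by omega
    have h2 : (h + n + 1 - (h + 1)).toNat = n := by omega
    have h3 : h + 1 ≤ h + n + 1 := by omega
    simp only [Function.update, hz.ne', hz.le, h1, h2, h3]
    simp

theorem act_left (c : Option Γ) :
    (zip h (c :: l) (a :: r)).act (b, .left) = zip (h - 1) l (c :: b :: r) := by
  simp only [zip, act, HeadMove.shift, mk.injEq]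
  refine ⟨rfl, ?_⟩
  funext z
  rcases lt_trichotomy z h with hz | rfl | hz
  · obtain ⟨n, rfl⟩ : ∃ n : ℕ, z = h - n - 1 := ⟨(h - z - 1).toNat, by omega⟩
    have h1 : (h - 1 - (h - n - 1)).toNat = n := by omega
    simp only [Function.update, hz.ne, not_le.2 hz, h1]
    cases n with
    | zero => simp
    | succ n =>
      have h3 : ¬ h - 1 ≤ h - (n + 1 : ℕ) - 1 := by omega
      have h2 : (h - 1 - 1 - (h - (n + 1 : ℕ) - 1)).toNat = n := by omega
      simp only [h3, h2]
      simp
  · simp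
  · obtain ⟨n, rfl⟩ : ∃ n : ℕ, z = h + n + 1 := ⟨(z - h - 1).toNat, by omega⟩
    have h1 : (h + n + 1 - h).toNat = n + 1 := by omega
    have h2 : (h + n + 1 - (h - 1)).toNat = n + 2 := by omega
    have h3 : h - 1 ≤ h + n + 1 := by omega
    simp only [Function.update, hz.ne', hz.le, h1, h2, h3]
    simp

theorem zip_none_right : zip h l [none] = zip h l [] := zip_append_none_right h l []

theorem zip_none_left : zip h [none] r = zip h [] r := zip_append_none_left h [] r

theorem act_right_nil : (zip h l []).act (b, .right) = zip (h + 1) (b :: l) [] := by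
  rw [← zip_none_right, act_right]

theorem move_right : (zip h l (a :: r)).act (a, .right) = zip (h + 1) (a :: l) r := act_right ..

theorem move_left : (zip h (a :: l) r).act ((zip h (a :: l) r).read, .left) =
    zip (h - 1) l (a :: r) := by
  cases r with
  | nil => rw [read_zip_nil, ← zip_none_right, act_left,
      show [a, none] = [a] ++ [none] from rfl, zip_append_none_right]
  | cons b r => rw [read_zip_cons, act_left]

theorem move_left_nil : (zip h [] r).act ((zip h [] r).read, .left) =
    zip (h - 1) [] (none :: r) := by
  rw [← zip_none_left, move_left]

theorem act_left_nil : (zip h [] (a :: r)).act (b, .left) = zip (h - 1) [] (none :: b :: r) := by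
  rw [← zip_none_left, act_left]

end Tape

/-- The contents of all tapes, indexed by `ι`. -/
abbrev Conf (ι Γ : Type) := ι → Tape Γ

/-- A program fragment for a multi-tape machine: a finite control with an entry point, where the
next control state `none` stands for leaving the fragment. Every choice is between at most two
alternatives. -/
structure Prog (ι Γ : Type) where
  S : Type
  fin : Finite S
  entry : S
  tr : S → (ι → Option Γ) → List (Option S × (ι → Option Γ × HeadMove))
  bin : ∀ s r, (tr s r).length ≤ 2

/-- The distribution obtained by choosing between two distributions with a fair coin. -/
noncomputable def mix (μ₀ μ₁ : PMF ℕ) : PMF ℕ :=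
  (PMF.uniformOfFintype Bool).bind fun e => if e then μ₁ else μ₀

/-- The action that rewrites the symbols read and moves no head. -/
def idle {ι Γ : Type} (r : ι → Option Γ) : ι → Option Γ × HeadMove := fun i => (r i, .stay)

theorem act_idle {ι Γ : Type} (T : Conf ι Γ) :
    (fun i => (T i).act (idle (fun i => (T i).read) i)) = T := by
  simp [idle]

theorem act_update {ι Γ : Type} [DecidableEq ι] (T : Conf ι Γ) (g : ι → Option Γ × HeadMove) (i : ι)
    (a : Option Γ × HeadMove) :
    (fun k => (T k).act (Function.update g i a k)) =
      Function.update (fun k => (T k).act (g k)) i ((T i).act a) := by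
  funext k
  by_cases h : k = i
  · subst h; simp
  · simp [h]

namespace Prog

variable {ι Γ : Type}

/-- The possible next control states and tape contents. -/
def next (p : Prog ι Γ) (s : p.S) (T : Conf ι Γ) : List (Option p.S × Conf ι Γ) :=
  (p.tr s fun i => (T i).read).map fun a => (a.1, fun i => (T i).act (a.2 i))

/-- A postcondition relates tape contents, a remaining time budget and the distribution of the
value computed by the rest of the computation. -/
abbrev Post (ι Γ : Type) := Conf ι Γ → ℕ → PMF ℕ → Prop

/-- `p.Wp post s T t μ`: when the fragment `p` is started in the control state `s` with tape
contents `T` and time budget `t`, then every computation leaves `p` in time, and in such a way that,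
if `post` describes how the computation continues after `p`, the value finally computed has
distribution `μ`. A part of the budget may be wasted on leaving `p`. -/
inductive Wp (p : Prog ι Γ) (post : Post ι Γ) : Option p.S → Conf ι Γ → ℕ → PMF ℕ → Prop
  | exit {T t t' μ} (h : post T t μ) (ht : t ≤ t') : Wp p post none T t' μ
  | det {s T s' T' t μ} (h : p.next s T = [(s', T')]) (hw : Wp p post s' T' t μ) :
      Wp p post (some s) T (t + 1) μ
  | flip {s T s₀ T₀ s₁ T₁ t μ₀ μ₁} (h : p.next s T = [(s₀, T₀), (s₁, T₁)])
      (h₀ : Wp p post s₀ T₀ t μ₀) (h₁ : Wp p post s₁ T₁ t μ₁) :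
      Wp p post (some s) T (t + 1) (mix μ₀ μ₁)

variable {p q : Prog ι Γ} {post post' : Post ι Γ} {T T' T'' : Conf ι Γ} {t t' : ℕ} {μ : PMF ℕ}

theorem Wp.mono {s : Option p.S} (h : p.Wp post s T t μ) : ∀ {t'}, t ≤ t' → p.Wp post s T t' μ := by
  induction h with
  | exit h ht => exact fun ht' => .exit h (ht.trans ht')
  | det h _ ih =>
    intro t' ht'
    obtain ⟨t', rfl⟩ : ∃ u, t' = u + 1 := ⟨t' - 1, by omega⟩
    exact .det h (ih (by omega))
  | flip h _ _ ih₀ ih₁ =>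
    intro t' ht'
    obtain ⟨t', rfl⟩ : ∃ u, t' = u + 1 := ⟨t' - 1, by omega⟩
    exact .flip h (ih₀ (by omega)) (ih₁ (by omega))

/-- Computations are carried over along a map of control states that respects transitions. -/
theorem Wp.transfer (f : Option p.S → Option q.S)
    (hf : ∀ s, ∃ s', f (some s) = some s' ∧
      ∀ r, q.tr s' r = (p.tr s r).map fun a => (f a.1, a.2))
    (hpost : ∀ T t μ, post T t μ → q.Wp post' (f none) T t μ) {s : Option p.S}
    (h : p.Wp post s T t μ) : q.Wp post' (f s) T t μ := by
  have key : ∀ s s', (∀ r, q.tr s' r = (p.tr s r).map fun a => (f a.1, a.2)) → ∀ T,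
      q.next s' T = (p.next s T).map fun a => (f a.1, a.2) := by
    intro s s' h T
    simp [next, h]
  induction h with
  | exit h ht => exact (hpost _ _ _ h).mono ht
  | @det s T s' T' t μ h _ ih =>
    obtain ⟨u, hu, htr⟩ := hf s
    rw [hu]
    exact .det (by rw [key s u htr, h]; rfl) ih
  | @flip s T s₀ T₀ s₁ T₁ t μ₀ μ₁ h _ _ ih₀ ih₁ =>
    obtain ⟨u, hu, htr⟩ := hf s
    rw [hu]
    exact .flip (by rw [key s u htr, h]; rfl) ih₀ ih₁

/-- Starting a fragment at its entry point. -/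
abbrev Start (p : Prog ι Γ) (post : Post ι Γ) : Post ι Γ := p.Wp post (some p.entry)

/-- A single deterministic step. -/
def step (f : (ι → Option Γ) → ι → Option Γ × HeadMove) : Prog ι Γ where
  S := Unit
  fin := inferInstance
  entry := ()
  tr _ r := [(none, f r)]
  bin _ _ := by simp

/-- Sequential composition. -/
def seq (p q : Prog ι Γ) : Prog ι Γ where
  S := p.S ⊕ q.S
  fin := by have := p.fin; have := q.fin; infer_instance
  entry := .inl p.entry
  tr s r := match s with
    | .inl s => (p.tr s r).map fun a => (some (a.1.elim (.inr q.entry) .inl), a.2)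
    | .inr s => (q.tr s r).map fun a => (a.1.map .inr, a.2)
  bin s r := by cases s <;> simp [p.bin, q.bin]

/-- Repetition, as long as tape `i` shows no blank. -/
def loop (i : ι) (p : Prog ι Γ) : Prog ι Γ where
  S := Option p.S
  fin := by have := p.fin; infer_instance
  entry := none
  tr s r := match s with
    | none => [(if r i = none then none else some (some p.entry), idle r)]
    | some s => (p.tr s r).map fun a => (some a.1, a.2)
  bin s r := by cases s <;> simp [p.bin]

/-- The postcondition of the first part of a composition is that the second part can be started. -/
theorem start_seq (h : p.Start (q.Start post) T t μ) : (p.seq q).Start post T t μ := by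
  refine Wp.transfer (p := p) (q := p.seq q) (fun s => some (s.elim (.inr q.entry) .inl))
    (fun s => ⟨_, rfl, fun r => rfl⟩) (fun T t μ h => ?_) h
  exact Wp.transfer (p := q) (q := p.seq q) (fun s => s.map .inr)
    (fun s => ⟨_, rfl, fun r => rfl⟩) (fun T t μ h => .exit h le_rfl) h

theorem start_loop_exit {i : ι} (hi : (T i).read = none) (h : post T t μ) :
    (loop i p).Start post T (t + 1) μ := by
  refine .det (s' := none) (T' := T) ?_ (.exit h le_rfl)
  simp [next, loop, hi, act_idle]

theorem start_loop_enter {i : ι} (hi : (T i).read ≠ none)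
    (h : p.Start ((loop i p).Start post) T t μ) : (loop i p).Start post T (t + 1) μ := by
  refine .det (s' := some (some p.entry)) (T' := T) ?_ ?_
  · simp [next, loop, hi, act_idle]
  · exact Wp.transfer (p := p) (q := loop i p) (fun s => some s)
      (fun s => ⟨_, rfl, fun r => rfl⟩) (fun T t μ h => h) h

/-- `p.Det T n T'`: started with tape contents `T`, the fragment `p` is left after at most `n` steps
with tape contents `T'`, without any choice. -/
def Det (p : Prog ι Γ) (T : Conf ι Γ) (n : ℕ) (T' : Conf ι Γ) : Prop :=
  ∀ post t μ, post T' t μ → p.Start post T (t + n) μ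

theorem Det.mono {n n' : ℕ} (h : p.Det T n T') (hn : n ≤ n') : p.Det T n' T' :=
  fun post t μ ht => (h post t μ ht).mono (by omega)

theorem Det.of_eq {n n' : ℕ} (h : p.Det T n T') (hn : n ≤ n') (hT : T' = T'') : p.Det T n' T'' :=
  hT ▸ h.mono hn

theorem Det.seq {n n' : ℕ} (h : p.Det T n T') (h' : q.Det T' n' T'') :
    (p.seq q).Det T (n + n') T'' := by
  intro post t μ ht
  have := h _ _ _ (h' _ _ _ ht)
  exact (start_seq this).mono (by omega)

theorem det_loop_exit {i : ι} (hi : (T i).read = none) : (loop i p).Det T 1 T :=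
  fun _ _ _ ht => start_loop_exit hi ht

theorem det_loop_enter {i : ι} {n n' : ℕ} (hi : (T i).read ≠ none) (h : p.Det T n T')
    (h' : (loop i p).Det T' n' T'') : (loop i p).Det T (n + n' + 1) T'' :=
  fun _ _ _ ht => (start_loop_enter hi (h _ _ _ (h' _ _ _ ht))).mono (by omega)

theorem det_step (f : (ι → Option Γ) → ι → Option Γ × HeadMove) :
    (step f).Det T 1 fun i => (T i).act (f (fun i => (T i).read) i) :=
  fun _ _ _ ht => .det (s' := none) rfl (.exit ht le_rfl)

variable [DecidableEq ι]

/-- A step that changes one tape only. -/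
def on (i : ι) (f : Option Γ → Option Γ × HeadMove) : Prog ι Γ :=
  step fun r => Function.update (idle r) i (f (r i))

theorem det_on (i : ι) (f : Option Γ → Option Γ × HeadMove) :
    (on i f).Det T 1 (Function.update T i ((T i).act (f (T i).read))) := by
  have := det_step (T := T) fun r => Function.update (idle r) i (f (r i))
  simp only [act_update, act_idle] at this
  exact this

end Prog

/-! ### Elementary programs: moving, erasing, copying, adding -/

open Tape

namespace Prog

variable {ι Γ : Type} [DecidableEq ι] {T T' : Conf ι Γ}

/-- Move the head of tape `i` to the right until it reads a blank. -/
def goRight (i : ι) : Prog ι Γ := loop i (on i fun s => (s, .right))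

theorem det_goRight {i : ι} (w : List Γ) : ∀ {T : Conf ι Γ} {h l}, T i = zip h l (w.map some) →
    (goRight i).Det T (2 * w.length + 1)
      (Function.update T i (zip (h + w.length) ((w.map some).reverse ++ l) [])) := by
  induction w with
  | nil =>
    intro T h l hT
    have hi : (T i).read = none := by simp [hT]
    refine (det_loop_exit hi).of_eq (by simp) ?_
    rw [eq_comm, Function.update_eq_self_iff]
    simpa using hT.symm
  | cons a w ih =>
    intro T h l hT
    have hi : (T i).read ≠ none := by simp [hT]
    have h1 := det_on (T := T) i fun s => (s, .right)
    rw [hT, List.map_cons, read_zip_cons, move_right] at h1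
    have := det_loop_enter hi h1 (ih (Function.update_self ..))
    simp only [Function.update_idem] at this
    refine this.of_eq (by simp only [List.length_cons]; omega) ?_
    congr 2
    · push_cast [List.length_cons]; ring
    · simp

/-- Move the head of tape `i` back to the left end of the non-blank block to the left of it. -/
def rewind (i : ι) : Prog ι Γ :=
  (on i fun s => (s, .left)).seq <| (loop i (on i fun s => (s, .left))).seq <|
    on i fun s => (s, .right)

theorem det_loop_left {i : ι} (w : List Γ) : ∀ {T : Conf ι Γ} {h a r},
    T i = zip h (w.map some) (some a :: r) →
    (loop i (on i fun s => (s, .left))).Det T (2 * w.length + 3)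
      (Function.update T i
        (zip (h - w.length - 1) [] (none :: ((w.map some).reverse ++ some a :: r)))) := by
  induction w with
  | nil =>
    intro T h a r hT
    have hi : (T i).read ≠ none := by simp [hT]
    have h1 := det_on (T := T) i fun s => (s, .left)
    rw [hT, List.map_nil, move_left_nil] at h1
    have := det_loop_enter hi h1 (det_loop_exit (by simp))
    simpa using this
  | cons b w ih =>
    intro T h a r hT
    have hi : (T i).read ≠ none := by simp [hT]
    have h1 := det_on (T := T) i fun s => (s, .left)
    rw [hT, List.map_cons, move_left] at h1
    have := det_loop_enter hi h1 (ih (Function.update_self ..))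
    simp only [Function.update_idem] at this
    refine this.of_eq (by simp only [List.length_cons]; omega) ?_
    congr 2
    · push_cast [List.length_cons]; ring
    · simp

theorem det_rewind {i : ι} (w : List Γ) {h r} (hT : T i = zip h (w.map some) r) :
    (rewind i).Det T (2 * w.length + 3)
      (Function.update T i (zip (h - w.length) [] ((w.map some).reverse ++ r))) := by
  have h1 := det_on (T := T) i fun s => (s, .left)
  cases w with
  | nil =>
    rw [hT, List.map_nil, move_left_nil] at h1
    have h3 := det_on (T := Function.update T i (zip (h - 1) [] (none :: r))) i fun s => (s, .right)
    simp only [Function.update_self, read_zip_cons, move_right, Function.update_idem,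
      zip_none_left] at h3
    refine (h1.seq (Det.seq (det_loop_exit (by simp)) h3)).of_eq (by simp) ?_
    simp
  | cons a w =>
    rw [hT, List.map_cons, move_left] at h1
    have h2 := det_loop_left (i := i)
      (T := Function.update T i (zip (h - 1) (w.map some) (some a :: r))) w
      (Function.update_self ..)
    simp only [Function.update_idem] at h2
    have h3 := det_on (T := Function.update T i
      (zip (h - 1 - w.length - 1) [] (none :: ((w.map some).reverse ++ some a :: r)))) i
      fun s => (s, .right)
    simp only [Function.update_self, read_zip_cons, move_right, Function.update_idem,
      zip_none_left] at h3
    refine (h1.seq (h2.seq h3)).of_eq (by simp only [List.length_cons]; omega) ?_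
    congr 2
    · push_cast [List.length_cons]; ring
    · simp

/-- Erase the non-blank block around the head of tape `i`. The symbol `m` is written first if the
head reads a blank, so that the head stands inside the block. -/
def clean (m : Γ) (i : ι) : Prog ι Γ :=
  (on i fun s => (some (s.getD m), .stay)).seq <| (goRight i).seq <|
    (on i fun s => (s, .left)).seq <| loop i (on i fun _ => (none, .left))

theorem det_loop_erase {i : ι} (w : List Γ) : ∀ {T : Conf ι Γ} {h a},
    T i = zip h (w.map some) [some a] →
    (loop i (on i fun _ => (none, .left))).Det T (2 * w.length + 3)
      (Function.update T i (zip (h - w.length - 1) [] [])) := by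
  induction w with
  | nil =>
    intro T h a hT
    have hi : (T i).read ≠ none := by simp [hT]
    have h1 := det_on (T := T) i fun _ => (none, .left)
    rw [hT, List.map_nil, act_left_nil, show [none, (none : Option Γ)] = [none] ++ [none] from rfl,
      zip_append_none_right, zip_none_right] at h1
    have := det_loop_enter hi h1 (det_loop_exit (by simp))
    simpa using this
  | cons b w ih =>
    intro T h a hT
    have hi : (T i).read ≠ none := by simp [hT]
    have h1 := det_on (T := T) i fun _ => (none, .left)
    rw [hT, List.map_cons, act_left, show [some b, none] = [some b] ++ [none] from rfl,
      zip_append_none_right] at h1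
    have := det_loop_enter hi h1 (ih (Function.update_self ..))
    simp only [Function.update_idem] at this
    refine this.of_eq (by simp only [List.length_cons]; omega) ?_
    congr 2
    · push_cast [List.length_cons]; ring

theorem det_clean {m : Γ} {i : ι} {w v : List Γ} {h s}
    (hT : T i = zip h (w.map some) (s :: v.map some)) :
    ∃ t : Tape Γ, t.Blank ∧
      (clean m i).Det T (2 * w.length + 4 * v.length + 10) (Function.update T i t) := by
  have h1 := det_on (T := T) i fun s => (some (s.getD m), .stay)
  rw [hT, read_zip_cons, act_stay] at h1
  have h2 := det_goRight (i := i) (T := Function.update T i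
    (zip h (w.map some) (some (s.getD m) :: v.map some))) (s.getD m :: v) (Function.update_self ..)
  simp only [Function.update_idem] at h2
  -- After the head has run to the right end, `a :: u` is the block read from right to left.
  obtain ⟨a, u, hu⟩ : ∃ a u, v.reverse ++ s.getD m :: w = a :: u := by
    cases hv : v.reverse ++ s.getD m :: w with
    | nil => simp at hv
    | cons a u => exact ⟨a, u, rfl⟩
  have hu' : ((s.getD m :: v).map some).reverse ++ w.map some = some a :: u.map some := by
    rw [← List.map_cons, ← hu]; simp
  rw [hu'] at h2
  have h3 := det_on (T := Function.update T i
    (zip (h + ↑(s.getD m :: v).length) (some a :: u.map some) [])) i fun s => (s, .left)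
  simp only [Function.update_self, Function.update_idem, move_left] at h3
  have h4 := det_loop_erase (i := i) (T := Function.update T i
    (zip (h + ↑(s.getD m :: v).length - 1) (u.map some) [some a])) u (Function.update_self ..)
  simp only [Function.update_idem] at h4
  have hlen := congrArg List.length hu
  simp only [List.length_append, List.length_reverse, List.length_cons] at hlen
  exact ⟨_, ⟨_, rfl⟩, (h1.seq (h2.seq (h3.seq h4))).mono (by simp only [List.length_cons]; omega)⟩

/-- Append a copy of the word on tape `i`, translated symbol by symbol, to tape `j`; then move both
heads back. -/
def copy (g : Γ → Γ) (i j : ι) : Prog ι Γ :=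
  (loop i (step fun r => Function.update (Function.update (idle r) i (r i, .right)) j
    ((r i).map g, .right))).seq <| (rewind i).seq (rewind j)

theorem det_loop_copy {g : Γ → Γ} {i j : ι} (hij : i ≠ j) (w : List Γ) :
    ∀ {T : Conf ι Γ} {h l h' l'}, T i = zip h l (w.map some) → T j = zip h' l' [] →
    (loop i (step fun r => Function.update (Function.update (idle r) i (r i, .right)) j
      ((r i).map g, .right))).Det T (2 * w.length + 1)
      (Function.update (Function.update T i (zip (h + w.length) ((w.map some).reverse ++ l) []))
        j (zip (h' + w.length) (((w.map g).map some).reverse ++ l') [])) := by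
  induction w with
  | nil =>
    intro T h l h' l' hT hT'
    have hi : (T i).read = none := by simp [hT]
    refine (det_loop_exit hi).of_eq (by simp) ?_
    have h1 := Function.update_eq_self i T
    have h2 := Function.update_eq_self j T
    rw [hT] at h1
    rw [hT'] at h2
    simp only [List.map_nil] at h1
    simp [h1, h2]
  | cons a w ih =>
    intro T h l h' l' hT hT'
    have hi : (T i).read ≠ none := by simp [hT]
    have h1 := det_step (T := T) fun r => Function.update
      (Function.update (idle r) i (r i, .right)) j ((r i).map g, .right)
    simp only [act_update, act_idle] at h1
    rw [hT, hT', List.map_cons, read_zip_cons, move_right, act_right_nil] at h1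
    have := det_loop_enter hi h1
      (ih (by rw [Function.update_of_ne hij, Function.update_self]) (Function.update_self ..))
    rw [Function.update_comm hij.symm, Function.update_idem, Function.update_idem] at this
    refine this.of_eq (by simp only [List.length_cons]; omega) ?_
    congr 2
    · congr 1
      · push_cast [List.length_cons]; ring
      · simp
    · push_cast [List.length_cons]; ring
    · simp

theorem det_copy {g : Γ → Γ} {i j : ι} (hij : i ≠ j) {w : List Γ} {h h' : ℤ}
    (hi : T i = zip h [] (w.map some)) (hj : T j = zip h' [] []) :
    (copy g i j).Det T (6 * w.length + 7)
      (Function.update T j (zip h' [] ((w.map g).map some))) := by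
  have h1 := det_loop_copy (g := g) hij w hi hj
  set T₁ := Function.update (Function.update T i (zip (h + w.length) ((w.map some).reverse ++ [])
    [])) j (zip (h' + w.length) (((w.map g).map some).reverse ++ []) []) with hT₁
  have h2 := det_rewind (T := T₁) (i := i) w.reverse (h := h + w.length) (r := [])
    (by simp [hT₁, hij])
  set T₂ := Function.update T₁ i (zip (h + w.length - w.reverse.length) []
    ((w.reverse.map some).reverse ++ [])) with hT₂
  have h3 := det_rewind (T := T₂) (i := j) (w.map g).reverse (h := h' + w.length) (r := [])
    (by simp [hT₁, hT₂, hij.symm])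
  refine (h1.seq (h2.seq h3)).of_eq (by simp; omega) ?_
  rw [hT₂, hT₁, Function.update_comm hij.symm, Function.update_idem, Function.update_idem]
  simp only [List.append_nil, ← List.map_reverse, List.reverse_reverse, List.length_reverse,
    List.length_map, add_sub_cancel_right, ← hi, Function.update_eq_self]

/-- Propagation of a carry in a binary number, least significant digit first: the digits passed and
the remaining digits. -/
def carry : Bool → List Bool → List Bool × List Bool
  | false, u => ([], u)
  | true, [] => ([true], [])
  | true, b :: u => ((!b) :: (carry b u).1, (carry b u).2)

/-- The addition of `2 ^ D - 1`, or of `2 ^ D` if there is a carry in the beginning, to a binary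
number, least significant digit first: the digits passed and the remaining digits. -/
def addOnes : ℕ → Bool → List Bool → List Bool × List Bool
  | 0, c, u => carry c u
  | D + 1, c, u => ((u.headD false == c) :: (addOnes D (u.headD false || c) u.tail).1,
      (addOnes D (u.headD false || c) u.tail).2)

/-- The digits of the sum computed by `addOnes`. -/
def sumOnes (D : ℕ) (c : Bool) (u : List Bool) : List Bool :=
  (addOnes D c u).1 ++ (addOnes D c u).2

theorem binVal_cons (b : Bool) (u : List Bool) :
    NTM.binVal (b :: u) = b.toNat + 2 * NTM.binVal u := by
  simp [NTM.binVal, Nat.ofDigits_cons]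

theorem binVal_carry (u : List Bool) : ∀ c, NTM.binVal ((carry c u).1 ++ (carry c u).2) =
    NTM.binVal u + c.toNat := by
  induction u with
  | nil => rintro (_ | _) <;> simp [carry, NTM.binVal]
  | cons b u ih =>
    rintro (_ | _)
    · simp [carry]
    · simp only [carry, List.cons_append, binVal_cons, ih]
      cases b <;> simp <;> ring

theorem binVal_sumOnes (D : ℕ) : ∀ c u,
    NTM.binVal (sumOnes D c u) + 1 = NTM.binVal u + 2 ^ D + c.toNat := by
  induction D with
  | zero => intro c u; simp only [sumOnes, addOnes, binVal_carry]; ring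
  | succ D ih =>
    intro c u
    have := ih (u.headD false || c) u.tail
    simp only [sumOnes] at this
    have h2 : NTM.binVal u = (u.headD false).toNat + 2 * NTM.binVal u.tail := by
      cases u with
      | nil => simp [NTM.binVal]
      | cons b u => simp [binVal_cons]
    simp only [sumOnes, addOnes, List.cons_append, binVal_cons]
    rw [h2, pow_succ]
    generalize u.headD false = b at *
    cases b <;> cases c <;> simp at * <;> omega

theorem count_carry (u : List Bool) : ∀ c, (carry c u).1.length +
    ((carry c u).1 ++ (carry c u).2).count true ≤ u.count true + 2 := by
  induction u with
  | nil => rintro (_ | _) <;> simp [carry]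
  | cons b u ih =>
    rintro (_ | _)
    · simp [carry]
    · have h1 := ih true
      cases b
      · simp [carry]; omega
      · simp [carry] at h1 ⊢; omega

/-- The number of digits passed is paid for by digits `1` that disappear, up to a term that does not
depend on the length of the number. -/
theorem count_sumOnes (D : ℕ) : ∀ c u, (addOnes D c u).1.length + (sumOnes D c u).count true ≤
    u.count true + 2 * D + 2 := by
  induction D with
  | zero => intro c u; exact count_carry u c
  | succ D ih =>
    intro c u
    have := ih (u.headD false || c) u.tail
    have h2 : u.count true = (u.headD false).toNat + u.tail.count true := by
      cases u with
      | nil => simp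
      | cons b u => cases b <;> simp; omega
    simp only [sumOnes, addOnes, List.cons_append, List.length_cons, List.count_cons] at this ⊢
    rw [h2]
    generalize u.headD false = b at *
    cases b <;> cases c <;> simp at * <;> omega

/-- Add `2 ^ D - 1`, where `D` is the length of the word on tape `i`, and the carry `c` to the
number on tape `j`. The control state is the current carry; in the range of the word on tape `i`,
the digit `b` of tape `j` and the carry `c` give `b + 1 + c`. The digits are written by means of
`enc` and read by means of `dec`. -/
def adder (enc : Bool → Γ) (dec : Option Γ → Bool) (i j : ι) (c : Bool) : Prog ι Γ where
  S := Bool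
  fin := inferInstance
  entry := c
  tr c r :=
    if r i ≠ none then
      [(some (dec (r j) || c), Function.update (Function.update (idle r) i (r i, .right)) j
        (some (enc (dec (r j) == c)), .right))]
    else if c then
      [(some (dec (r j)), Function.update (idle r) j (some (enc (!dec (r j))), .right))]
    else [(none, idle r)]
  bin c r := by split_ifs <;> simp

section adder
variable {enc : Bool → Γ} {dec : Option Γ → Bool} {i j : ι}

theorem dec_read (h0 : dec none = false) (h1 : ∀ b, dec (some (enc b)) = b) (h : ℤ)
    (l : List (Option Γ)) (u : List Bool) :
    dec (zip h l ((u.map enc).map some)).read = u.headD false := by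
  cases u <;> simp [h0, h1]

theorem act_right_digits (h : ℤ) (l : List (Option Γ)) (u : List Bool) (s : Option Γ) :
    (zip h l ((u.map enc).map some)).act (s, .right) =
      zip (h + 1) (s :: l) ((u.tail.map enc).map some) := by
  cases u with
  | nil => exact act_right_nil ..
  | cons b u => exact act_right ..

theorem wp_adder_carry (h0 : dec none = false) (h1 : ∀ b, dec (some (enc b)) = b) {c₀ : Bool}
    {post : Post ι Γ} {μ : PMF ℕ} (u : List Bool) :
    ∀ {T : Conf ι Γ} {c h l t}, (T i).read = none → i ≠ j → T j = zip h l ((u.map enc).map some) →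
    post (Function.update T j (zip (h + (carry c u).1.length)
      ((((carry c u).1.map enc).map some).reverse ++ l) (((carry c u).2.map enc).map some))) t μ →
    (adder enc dec i j c₀).Wp post (some c) T (t + (carry c u).1.length + 1) μ := by
  have key : ∀ {T : Conf ι Γ} {h l} {u : List Bool}, (T i).read = none →
      T j = zip h l ((u.map enc).map some) →
      (adder enc dec i j c₀).next true T = [(some (u.headD false),
        Function.update T j (zip (h + 1) (some (enc (!u.headD false)) :: l)
          ((u.tail.map enc).map some)))] := by
    intro T h l u hi hj
    simp [next, adder, hi, act_update, act_idle, hj, -List.map_map, dec_read h0 h1,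
      act_right_digits]
  have keyf : ∀ {T : Conf ι Γ}, (T i).read = none →
      (adder enc dec i j c₀).next false T = [(none, T)] := by
    intro T hi
    simp [next, adder, hi, act_idle]
  induction u with
  | nil =>
    rintro T (_ | _) h l t hi hij hj hp
    · refine .det (keyf hi) (.exit (t := t) ?_ (by simp [carry]))
      have h2 := Function.update_eq_self j T
      rw [hj] at h2
      simp only [List.map_nil] at h2
      simpa [carry, h2] using hp
    · refine .det (key hi hj) (.det (keyf ?_) (.exit (t := t) ?_ le_rfl))
      · rwa [Function.update_of_ne hij]
      · simpa [carry] using hp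
  | cons b u ih =>
    rintro T (_ | _) h l t hi hij hj hp
    · refine .det (keyf hi) (.exit (t := t) ?_ (by simp [carry]))
      simp only [carry, List.length_nil, Nat.cast_zero, add_zero, List.map_nil, List.reverse_nil,
        List.nil_append] at hp
      rwa [← hj, Function.update_eq_self] at hp
    · refine .det (t := t + (carry b u).1.length + 1) (key hi hj)
        (ih (c := b) ?_ hij (Function.update_self ..) ?_)
      · rwa [Function.update_of_ne hij]
      · rw [Function.update_idem]
        convert hp using 3
        · simp [carry]; ring
        · simp [carry]
        · simp [carry]

theorem wp_adder (h0 : dec none = false) (h1 : ∀ b, dec (some (enc b)) = b) {c₀ : Bool}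
    {post : Post ι Γ} {μ : PMF ℕ} (hij : i ≠ j) (w : List Γ) :
    ∀ {T : Conf ι Γ} {c h l h' l' t} {u : List Bool},
    T i = zip h l (w.map some) → T j = zip h' l' ((u.map enc).map some) →
    post (Function.update
      (Function.update T i (zip (h + w.length) ((w.map some).reverse ++ l) []))
      j (zip (h' + (addOnes w.length c u).1.length)
      ((((addOnes w.length c u).1.map enc).map some).reverse ++ l')
      (((addOnes w.length c u).2.map enc).map some))) t μ →
    (adder enc dec i j c₀).Wp post (some c) T (t + (addOnes w.length c u).1.length + 1) μ := by
  induction w with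
  | nil =>
    intro T c h l h' l' t u hi hj hp
    refine wp_adder_carry h0 h1 u (by simp [hi]) hij hj ?_
    have : zip (h + ([] : List Γ).length) ((([] : List Γ).map some).reverse ++ l) [] = T i := by
      simp [hi]
    rwa [this, Function.update_eq_self] at hp
  | cons a w ih =>
    intro T c h l h' l' t u hi hj hp
    have key : (adder enc dec i j c₀).next c T = [(some (u.headD false || c),
        Function.update (Function.update T i (zip (h + 1) (some a :: l) (w.map some)))
          j (zip (h' + 1) (some (enc (u.headD false == c)) :: l')
            ((u.tail.map enc).map some)))] := by
      have hr : (T i).read = some a := by simp [hi]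
      simp [next, adder, hr, act_update, act_idle, hj, -List.map_map, dec_read h0 h1,
        act_right_digits]
      simp [hi, move_right]
    refine .det key (ih (u := u.tail)
      (by rw [Function.update_of_ne hij, Function.update_self]) (Function.update_self ..) ?_)
    rw [Function.update_comm hij.symm, Function.update_idem, Function.update_idem]
    convert hp using 3
    · congr 1
      · push_cast [List.length_cons]; ring
      · simp
    · simp [addOnes]; ring
    · simp [addOnes]
    · simp [addOnes]

/-- `adder`, after which both heads are moved back. -/
def add (enc : Bool → Γ) (dec : Option Γ → Bool) (i j : ι) (c : Bool) : Prog ι Γ :=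
  (adder enc dec i j c).seq <| (rewind i).seq (rewind j)

theorem det_add (h0 : dec none = false) (h1 : ∀ b, dec (some (enc b)) = b) {c : Bool}
    (hij : i ≠ j) {w : List Γ} {h h' : ℤ} {u : List Bool}
    (hi : T i = zip h [] (w.map some)) (hj : T j = zip h' [] ((u.map enc).map some)) :
    (add enc dec i j c).Det T (2 * w.length + 3 * (addOnes w.length c u).1.length + 7)
      (Function.update T j (zip h' [] (((sumOnes w.length c u).map enc).map some))) := by
  set pr := (addOnes w.length c u).1 with hpr
  set rest := (addOnes w.length c u).2 with hrest
  set T₁ := Function.update (Function.update T i (zip (h + w.length) ((w.map some).reverse ++ [])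
    [])) j (zip (h' + pr.length) (((pr.map enc).map some).reverse ++ [])
      ((rest.map enc).map some)) with hT₁
  have h1 : (adder enc dec i j c).Det T (pr.length + 1) T₁ :=
    fun post t μ hp => wp_adder h0 h1 hij w hi hj hp
  have h2 := det_rewind (T := T₁) (i := i) w.reverse (h := h + w.length) (r := [])
    (by simp [hT₁, hij])
  set T₂ := Function.update T₁ i (zip (h + w.length - w.reverse.length) []
    ((w.reverse.map some).reverse ++ [])) with hT₂
  have h3 := det_rewind (T := T₂) (i := j) (pr.map enc).reverse (h := h' + pr.length)
    (r := (rest.map enc).map some) (by simp [hT₁, hT₂, hij.symm])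
  refine (h1.seq (h2.seq h3)).of_eq (by simp; omega) ?_
  rw [hT₂, hT₁, Function.update_comm hij.symm, Function.update_idem, Function.update_idem]
  simp only [List.append_nil, ← List.map_reverse, List.reverse_reverse, List.length_reverse,
    List.length_map, add_sub_cancel_right, ← hi, Function.update_eq_self, sumOnes, List.map_append,
    ← hpr, ← hrest]

end adder
end Prog

/-! ### Simulation of a nondeterministic machine with random choices -/

section

section bits
variable {a b : ℕ} {M : NTM a b}

/-- The distribution of the number of nondeterministic steps on a random computation of at most `t`
steps, each nondeterministic step being decided by a fair coin between the first two alternatives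
(a binary machine has no others). -/
noncomputable def branchings (M : NTM a b) : ℕ → M.Cfg → PMF ℕ
  | 0, _ => PMF.pure 0
  | t + 1, c =>
    match M.succs c with
    | [] => PMF.pure 0
    | [c'] => branchings M t c'
    | c₀ :: c₁ :: _ => (mix (branchings M t c₀) (branchings M t c₁)).map (· + 1)

/-- Every computation starting at `c` has at most `n` steps. -/
def HaltsFrom (M : NTM a b) (c : M.Cfg) (n : ℕ) : Prop := ∀ w k c', M.Run c w k c' → w.length ≤ n

theorem HaltsFrom.succ {c c' : M.Cfg} {n i : ℕ} (h : HaltsFrom M c (n + 1))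
    (hi : (M.succs c)[i]? = some c') : HaltsFrom M c' n := fun w k c'' hr => by
  simpa using h _ _ _ (.step hi hr)

theorem HaltsFrom.succs_eq_nil {c : M.Cfg} (h : HaltsFrom M c 0) : M.succs c = [] := by
  cases hc : M.succs c with
  | nil => rfl
  | cons c' l =>
    have h1 := h [0] _ c' (.step (by rw [hc]; rfl) (.refl c'))
    simp at h1

theorem mix_bind (μ₀ μ₁ : PMF ℕ) (κ : ℕ → PMF ℕ) :
    (mix μ₀ μ₁).bind κ = mix (μ₀.bind κ) (μ₁.bind κ) := by
  simp only [mix, PMF.bind_bind]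
  congr 1
  funext e
  cases e <;> rfl

end bits

/-- The tapes of the sampling machine: the input word, a unary number `m` such that the result is to
be divided by `2 ^ m`, numerator and denominator of the result, the depth of the current
computation path, three loop counters, and the tapes of the simulated machine. -/
inductive Tp (τ : Type)
  | input
  | scale
  | num
  | den
  | depth
  | ctr (c : Fin 3)
  | sim (i : τ)

noncomputable instance (τ : Type) : DecidableEq (Tp τ) := Classical.decEq _

variable {a b : ℕ} {M : NTM a b}

/-- The alphabet of the sampling machine: bits, and visited cells of the simulated machine. A
visited cell is never blank, even if it is blank for the simulated machine; so the visited cells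
form a block that can be found and erased after the simulation. -/
abbrev Alph (M : NTM a b) : Type := Bool ⊕ Option M.Symb

/-- The symbol of the simulated machine that is represented by a cell. -/
def decode (M : NTM a b) : Option (Alph M) → Option M.Symb
  | some (.inr s) => s
  | _ => none

/-- The tape `t` represents the tape `m` of the simulated machine, up to a translation, and at most
`n` cells besides the one under the head have been visited. -/
def Represents (t : Tape (Alph M)) (m : Tape M.Symb) (n : ℕ) : Prop :=
  ∃ h h' l s r, t = zip h ((l.map .inr).map some) (s :: (r.map .inr).map some) ∧
    m = zip h' l (decode M s :: r) ∧ l.length + r.length ≤ n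

theorem Represents.read {t : Tape (Alph M)} {m : Tape M.Symb} {n : ℕ} (ht : Represents t m n) :
    decode M t.read = m.read := by
  obtain ⟨h, h', l, s, r, rfl, rfl, -⟩ := ht
  simp

theorem Represents.act {t : Tape (Alph M)} {m : Tape M.Symb} {n : ℕ} (ht : Represents t m n)
    (x : Option M.Symb × HeadMove) :
    Represents (t.act (some (.inr x.1), x.2)) (m.act x) (n + 1) := by
  obtain ⟨h, h', l, s, r, rfl, rfl, hn⟩ := ht
  obtain ⟨x, d⟩ := x
  cases d with
  | stay =>
    exact ⟨h, h', l, some (.inr x), r, act_stay .., act_stay .., by omega⟩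
  | right =>
    cases r with
    | nil =>
      refine ⟨h + 1, h' + 1, x :: l, none, [], ?_, ?_, by simp at hn ⊢; omega⟩
      · exact (act_right ..).trans (zip_none_right ..).symm
      · exact (act_right ..).trans (zip_none_right ..).symm
    | cons y r =>
      exact ⟨h + 1, h' + 1, x :: l, some (.inr y), r, act_right .., act_right ..,
        by simp at hn ⊢; omega⟩
  | left =>
    cases l with
    | nil =>
      exact ⟨h - 1, h' - 1, [], none, x :: r, act_left_nil .., act_left_nil ..,
        by simp at hn ⊢; omega⟩
    | cons y l =>
      exact ⟨h - 1, h' - 1, l, some (.inr y), x :: r, act_left .., act_left ..,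
        by simp at hn ⊢; omega⟩

theorem Represents.mono {t : Tape (Alph M)} {m : Tape M.Symb} {n n' : ℕ} (ht : Represents t m n)
    (hn : n ≤ n') : Represents t m n' := by
  obtain ⟨h, h', l, s, r, h1, h2, h3⟩ := ht
  exact ⟨h, h', l, s, r, h1, h2, h3.trans hn⟩

/-- The mark written on the depth tape. -/
abbrev mark : Alph M := .inl true

/-- The action of the sampling machine corresponding to an action of the simulated machine. -/
def simAct (r : Tp M.TapeIdx → Option (Alph M)) (x : M.TapeIdx → Option M.Symb × HeadMove)
    (branch : Prop) [Decidable branch] : Tp M.TapeIdx → Option (Alph M) × HeadMove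
  | .sim i => (some (.inr (x i).1), (x i).2)
  | .depth => if branch then (some mark, .right) else (r .depth, .stay)
  | k => (r k, .stay)

/-- Simulation of the machine `M`, where each nondeterministic step leaves a mark on the depth
tape. -/
def simulate (M : NTM a b) (hbin : M.IsBinary) : Prog (Tp M.TapeIdx) (Alph M) where
  S := M.State
  fin := M.finite_state
  entry := M.start
  tr q r := match M.trans q (fun i => decode M (r (.sim i))) with
    | [] => [(none, idle r)]
    | [x] => [(some x.1, simAct r x.2 False)]
    | x :: y :: l => (x :: y :: l).map fun z => (some z.1, simAct r z.2 True)
  bin q r := by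
    have := hbin q (fun i => decode M (r (.sim i)))
    split <;> simp_all

/-- The tapes of a configuration. -/
def tapes (c : M.Cfg) (i : M.TapeIdx) : Tape M.Symb := ⟨c.head i, c.cells i⟩

/-- The tapes that are not used by the simulation. -/
def Tp.Untouched {τ : Type} : Tp τ → Prop
  | .depth => False
  | .sim _ => False
  | _ => True

/-- The contents of the tapes after an action of the simulated machine. -/
theorem simAct_spec {T : Conf (Tp M.TapeIdx) (Alph M)} {c : M.Cfg} {n : ℕ}
    (hT : ∀ i, Represents (T (.sim i)) (tapes c i) n) (x : M.Action)
    (branch : Prop) [Decidable branch] :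
    let T' : Conf (Tp M.TapeIdx) (Alph M) :=
      fun k => (T k).act (simAct (fun k => (T k).read) x.2 branch k)
    (∀ i, Represents (T' (.sim i)) (tapes (M.perform c x) i) (n + 1)) ∧
      (∀ k : Tp M.TapeIdx, k.Untouched → T' k = T k) ∧
      T' .depth = if branch then (T .depth).act (some mark, .right) else T .depth := by
  refine ⟨fun i => (hT i).act (x.2 i), fun k hk => ?_, ?_⟩
  · cases k <;> simp_all [simAct, Tp.Untouched]
  · by_cases h : branch <;> simp [simAct, h]

/-- If `M` is in the configuration `c` after `j` nondeterministic steps, the simulation continues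
with `D` further ones, where `D` is distributed according to `branchings M n c`, and then the depth
tape carries `j + D` marks. -/
theorem wp_simulate (hbin : M.IsBinary) {post : Prog.Post (Tp M.TapeIdx) (Alph M)} {t : ℕ} :
    ∀ (n : ℕ) {c : M.Cfg} {T : Conf (Tp M.TapeIdx) (Alph M)} {j N : ℕ} {κ : ℕ → PMF ℕ},
    HaltsFrom M c n → (∀ i, Represents (T (.sim i)) (tapes c i) N) →
    (∃ h, T .depth = zip h ((List.replicate j mark).map some) []) →
    (∀ D T', D ≤ n → (∀ k : Tp M.TapeIdx, k.Untouched → T' k = T k) →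
      (∀ i, ∃ m, Represents (T' (.sim i)) m (N + n)) →
      (∃ h, T' .depth = zip h ((List.replicate (j + D) mark).map some) []) →
      post T' t (κ (j + D))) →
    (simulate M hbin).Wp post (some c.state) T (t + n + 1)
      ((branchings M n c).bind fun D => κ (j + D)) := by
  have hread : ∀ {c : M.Cfg} {T : Conf (Tp M.TapeIdx) (Alph M)} {N : ℕ},
      (∀ i, Represents (T (.sim i)) (tapes c i) N) →
      (fun i => decode M (T (.sim i)).read) = fun i => c.cells i (c.head i) := by
    intro c T N hT
    funext i
    exact (hT i).read
  have halt : ∀ {n : ℕ} {c : M.Cfg} {T : Conf (Tp M.TapeIdx) (Alph M)} {j N : ℕ} {κ : ℕ → PMF ℕ},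
      M.succs c = [] → (∀ i, Represents (T (.sim i)) (tapes c i) N) →
      (∃ h, T .depth = zip h ((List.replicate j mark).map some) []) →
      (∀ D T', D ≤ n → (∀ k : Tp M.TapeIdx, k.Untouched → T' k = T k) →
        (∀ i, ∃ m, Represents (T' (.sim i)) m (N + n)) →
        (∃ h, T' .depth = zip h ((List.replicate (j + D) mark).map some) []) →
        post T' t (κ (j + D))) →
      (simulate M hbin).Wp post (some c.state) T (t + n + 1)
        ((PMF.pure 0).bind fun D => κ (j + D)) := by
    intro n c T j N κ hc hT hd hp
    have htr : M.trans c.state (fun i => c.cells i (c.head i)) = [] := by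
      simpa [NTM.succs] using hc
    rw [PMF.pure_bind]
    refine .det (s' := none) (T' := T) ?_ (.exit (t := t)
      (hp 0 T (by omega) (fun _ _ => rfl) (fun i => ⟨_, (hT i).mono (by omega)⟩) hd) (by omega))
    simp [Prog.next, simulate, hread hT, htr, act_idle]
  intro n
  induction n with
  | zero =>
    intro c T j N κ hc hT hd hp
    exact halt hc.succs_eq_nil hT hd hp
  | succ n ih =>
    intro c T j N κ hc hT hd hp
    cases htr : M.trans c.state (fun i => c.cells i (c.head i)) with
    | nil =>
      have hs : M.succs c = [] := by simp [NTM.succs, htr]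
      rw [branchings, hs]
      exact halt hs hT hd hp
    | cons x l => cases l with
      | nil =>
        have hs : M.succs c = [M.perform c x] := by simp [NTM.succs, htr]
        rw [branchings, hs]
        obtain ⟨h1, h2, h3⟩ := simAct_spec hT x False
        refine .det (s' := some x.1) (t := t + n + 1)
          (T' := fun k => (T k).act (simAct (fun k => (T k).read) x.2 False k)) ?_ ?_
        · simp [Prog.next, simulate, hread hT, htr]
        · refine ih (c := M.perform c x) (hc.succ (i := 0) (by simp [hs])) h1
            (by simpa [h3] using hd) ?_
          intro D T' hD hk hr hd'
          refine hp D T' (by omega) (fun k hk' => (hk k hk').trans (h2 k hk')) (fun i => ?_) hd'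
          obtain ⟨m, hm⟩ := hr i
          exact ⟨m, hm.mono (by omega)⟩
      | cons y l =>
        have hl : l = [] := by
          have := hbin c.state (fun i => c.cells i (c.head i))
          rw [htr] at this
          simpa using this
        subst hl
        have hs : M.succs c = [M.perform c x, M.perform c y] := by simp [NTM.succs, htr]
        rw [branchings, hs]
        have side : ∀ z, HaltsFrom M (M.perform c z) n →
            (simulate M hbin).Wp post (some z.1)
              (fun k => (T k).act (simAct (fun k => (T k).read) z.2 True k)) (t + n + 1)
              ((branchings M n (M.perform c z)).bind fun D => κ (j + 1 + D)) := by
          intro z hz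
          obtain ⟨h1, h2, h3⟩ := simAct_spec hT z True
          refine ih (c := M.perform c z) hz h1 ?_ ?_
          · obtain ⟨h, hd⟩ := hd
            refine ⟨h + 1, ?_⟩
            refine h3.trans ?_
            rw [if_pos trivial, hd, act_right_nil, List.replicate_succ, List.map_cons]
          · intro D T' hD hk hr hd'
            have := hp (D + 1) T' (by omega) (fun k hk' => (hk k hk').trans (h2 k hk'))
              (fun i => ?_) (by rwa [add_right_comm, add_assoc] at hd')
            · rwa [add_right_comm, add_assoc]
            · obtain ⟨m, hm⟩ := hr i
              exact ⟨m, hm.mono (by omega)⟩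
        have hn : (simulate M hbin).next c.state T =
            [(some x.1, fun k => (T k).act (simAct (fun k => (T k).read) x.2 True k)),
              (some y.1, fun k => (T k).act (simAct (fun k => (T k).read) y.2 True k))] := by
          simp [Prog.next, simulate, hread hT, htr]
        have := Prog.Wp.flip hn
          (side x (hc.succ (i := 0) (by simp [hs]))) (side y (hc.succ (i := 1) (by simp [hs])))
        convert this using 1
        · ring
        · simp only [PMF.map, PMF.bind_bind, Function.comp_def, PMF.pure_bind, mix_bind]
          simp only [add_assoc, add_comm 1]

end

/-! ### One round of the sampling machine -/

section

variable {M : NTM 1 0}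

theorem Represents.blank {a b : ℕ} {M : NTM a b} {t : Tape (Alph M)} (ht : t.Blank) (n : ℕ) :
    ∃ m, Represents t m n := by
  obtain ⟨h, rfl⟩ := ht
  exact ⟨_, h, 0, [], none, [], (zip_none_right ..).symm, rfl, by simp⟩

/-- The program that does nothing. -/
def skip {ι Γ : Type} : Prog ι Γ := .step idle

/-- Erase the tapes of the simulated machine that are listed in `l`. -/
noncomputable def cleanAll (M : NTM 1 0) (l : List M.TapeIdx) : Prog (Tp M.TapeIdx) (Alph M) :=
  l.foldr (fun i p => (Prog.clean mark (.sim i)).seq p) skip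

theorem det_cleanAll {n : ℕ} (l : List M.TapeIdx) : ∀ {T : Conf (Tp M.TapeIdx) (Alph M)},
    (∀ i, ∃ m, Represents (T (.sim i)) m n) →
    ∃ T', (cleanAll M l).Det T (l.length * (4 * n + 10) + 1) T' ∧
      (∀ k, (∀ i, k ≠ .sim i) → T' k = T k) ∧ (∀ i ∈ l, (T' (.sim i)).Blank) ∧
      ∀ i, (T (.sim i)).Blank → (T' (.sim i)).Blank := by
  induction l with
  | nil =>
    intro T _
    refine ⟨T, ?_, fun _ _ => rfl, by simp, fun _ h => h⟩
    have := Prog.det_step (T := T) idle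
    rw [act_idle] at this
    exact this.mono (by simp)
  | cons j l ih =>
    intro T hT
    obtain ⟨m, h, h', w, s, v, hj, -, hn⟩ := hT j
    obtain ⟨t, ht, hdet⟩ := Prog.det_clean (m := mark) hj
    set T₁ := Function.update T (.sim j) t with hT₁
    have h1 : ∀ i, ∃ m, Represents (T₁ (.sim i)) m n := by
      intro i
      by_cases hij : i = j
      · subst hij
        rw [hT₁, Function.update_self]
        exact Represents.blank ht n
      · rw [hT₁, Function.update_of_ne (by simpa using hij)]
        exact hT i
    have h2 : ∀ i, (T (.sim i)).Blank ∨ i = j → (T₁ (.sim i)).Blank := by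
      intro i hi
      by_cases hij : i = j
      · subst hij
        rwa [hT₁, Function.update_self]
      · rw [hT₁, Function.update_of_ne (by simpa using hij)]
        exact hi.resolve_right hij
    obtain ⟨T', hd, hk, hb, hb'⟩ := ih h1
    refine ⟨T', (hdet.seq hd).mono ?_, fun k hk' => ?_, fun i hi => ?_, fun i hi => ?_⟩
    · simp only [List.length_map, List.length_cons]
      rw [add_mul]
      omega
    · rw [hk k hk', hT₁, Function.update_of_ne (hk' j)]
    · rcases List.mem_cons.1 hi with rfl | hi
      · exact hb' _ (h2 _ (.inr rfl))
      · exact hb i hi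
    · exact hb' _ (h2 _ (.inl hi))

/-- The bit shown by a cell. -/
def bitOf {a b : ℕ} {M : NTM a b} : Option (Alph M) → Bool
  | some (.inl b) => b
  | _ => false

/-- A tape on which the word `w` is written from cell `0` on, with the head on cell `0`. -/
abbrev wordTape (M : NTM 1 0) (w : List Bool) : Tape (Alph M) := zip 0 [] ((w.map .inl).map some)

/-- The tape contents between two rounds of the sampling machine on input `x`: the numerator has the
digits `u`, the denominator the digits `v`. -/
structure Home (x : List Bool) (m : ℕ) (u v : List Bool) (T : Conf (Tp M.TapeIdx) (Alph M)) :
    Prop where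
  input : T .input = wordTape M x
  scale : T .scale = wordTape M (unary m)
  num : T .num = wordTape M u
  den : T .den = wordTape M v
  depth : (T .depth).Blank
  sim : ∀ i, (T (.sim i)).Blank

/-- Translation of the bits of the input into symbols of the simulated machine. -/
def toSim (M : NTM 1 0) : Alph M → Alph M
  | .inl b => .inr (some (M.bit b))
  | s => s

/-- The end of a round: if the depth tape shows that there were `D` nondeterministic steps, add
`2 ^ D - 1` to the numerator; add `2 ^ m` to the denominator, where `m` is the number on tape
`scale`; erase the depth tape and the tapes of the simulated machine. -/
noncomputable def settle (M : NTM 1 0) (l : List M.TapeIdx) : Prog (Tp M.TapeIdx) (Alph M) :=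
  (Prog.rewind .depth).seq <| (Prog.add .inl bitOf .depth .num false).seq <|
    (Prog.clean mark .depth).seq <| (Prog.add .inl bitOf .scale .den true).seq <| cleanAll M l

/-- One round: run the simulated machine on the input word, with coins deciding its nondeterministic
steps, and settle the accounts. -/
noncomputable def round (M : NTM 1 0) (hbin : M.IsBinary) (l : List M.TapeIdx) :
    Prog (Tp M.TapeIdx) (Alph M) :=
  (Prog.copy (toSim M) .input (.sim (.inl 0))).seq <| (simulate M hbin).seq <| settle M l

/-- The amortized cost of the end of a round. -/
def settleCost (c n P m : ℕ) : ℕ :=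
  (2 * P + 3) + (8 * P + 13) + (4 * P + 10) + (8 * m + 13) + (c * (4 * n + 10) + 1)

/-- The amortized cost of one round. -/
def roundCost (c n P m : ℕ) : ℕ := (6 * n + 7) + (P + 1) + settleCost c (n + P) P m

/-- Time paid in advance for the propagation of carries: every digit `1` pays for its later
replacement by `0`, i.e. for one step of the adder and two steps of the way back. -/
def potential (u v : List Bool) : ℕ := 3 * u.count true + 3 * v.count true

theorem mk_writeWord {a b : ℕ} (N : NTM a b) (w : List Bool) :
    (⟨0, N.writeWord w⟩ : Tape N.Symb) = zip 0 [] ((w.map N.bit).map some) := by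
  simp only [zip, Tape.mk.injEq, true_and]
  funext z
  by_cases hz : 0 ≤ z
  · simp only [NTM.writeWord, hz, if_true, sub_zero, List.getElem?_map]
    cases w[z.toNat]? <;> rfl
  · simp [NTM.writeWord, hz]

/-- After the input word has been copied, the tapes represent the initial configuration of the
simulated machine. -/
theorem represents_init (x : List Bool) (i : M.TapeIdx) {T : Conf (Tp M.TapeIdx) (Alph M)}
    (hT : ∀ i, (T (.sim i)).Blank) (h : ℤ) :
    Represents ((Function.update T (.sim (.inl 0))
      (zip h [] (((x.map (.inl : Bool → Alph M)).map (toSim M)).map some))) (.sim i))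
      (tapes (M.init ![x]) i) x.length := by
  by_cases hi : i = .inl 0
  · subst hi
    rw [Function.update_self]
    have key : tapes (M.init ![x]) (.inl 0) = zip 0 [] ((x.map M.bit).map some) :=
      mk_writeWord M x
    rw [key]
    cases x with
    | nil => exact ⟨h, 0, [], none, [], (zip_none_right ..).symm, (zip_none_right ..).symm, by simp⟩
    | cons b x =>
      refine ⟨h, 0, [], some (.inr (some (M.bit b))), x.map fun b => some (M.bit b), ?_, ?_, ?_⟩
      · simp [toSim, Function.comp_def]
      · simp [decode, Function.comp_def]
      · simp
  · rw [Function.update_of_ne (by simpa using hi)]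
    obtain ⟨h, hh⟩ := hT i
    refine ⟨h, 0, [], none, [], by rw [hh]; exact (zip_none_right ..).symm, ?_, by simp⟩
    refine Eq.trans ?_ (zip_none_right ..).symm
    rcases i with i | i | i
    · exact absurd (congrArg Sum.inl (Subsingleton.elim i 0)) hi
    · exact i.elim0
    · simp [tapes, NTM.init, zip]

/-- The time `N` may depend on the length of the numerator and the denominator, but its sum with the
potential afterwards exceeds the potential before by a bounded amount only. -/
theorem det_settle {l : List M.TapeIdx} (hl : ∀ i, i ∈ l) {x : List Bool}
    {P m n D : ℕ} (hD : D ≤ P) {u v : List Bool} {T : Conf (Tp M.TapeIdx) (Alph M)}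
    (hinp : T .input = wordTape M x) (hscale : T .scale = wordTape M (unary m))
    (hnum : T .num = wordTape M u) (hden : T .den = wordTape M v)
    (hdepth : ∃ h, T .depth = zip h ((List.replicate D mark).map some) [])
    (hsim : ∀ i, ∃ m, Represents (T (.sim i)) m n) :
    ∃ T' N, (settle M l).Det T N T' ∧
      N + potential (Prog.sumOnes D false u) (Prog.sumOnes m true v) ≤
        settleCost l.length n P m + potential u v ∧
      Home x m (Prog.sumOnes D false u) (Prog.sumOnes m true v) T' ∧
      ∀ c, T' (.ctr c) = T (.ctr c) := by
  obtain ⟨h, hdepth⟩ := hdepth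
  have d1 := Prog.det_rewind (T := T) (i := .depth) _ hdepth
  set w : List (Alph M) := List.replicate D mark with hw
  have hwl : w.length = D := by simp [hw]
  have hwr : (w.map some).reverse ++ [] = w.map some := by simp [hw]
  rw [hwr] at d1
  set T₁ := Function.update T .depth (zip (h - w.length) [] (w.map some)) with hT₁
  have d2 := Prog.det_add (T := T₁) (i := .depth) (j := .num) (c := false) (enc := .inl)
    (dec := bitOf (M := M)) rfl (fun _ => rfl) (by simp) (w := w) (u := u)
    (h := h - w.length) (h' := 0) (by simp [hT₁])
    ((Function.update_of_ne (by simp) _ _).trans hnum)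
  set T₂ := Function.update T₁ .num (wordTape M (Prog.sumOnes w.length false u)) with hT₂
  -- The depth tape may be blank, so the symbol `s` under its head need not be a mark.
  obtain ⟨s, v', hsv⟩ : ∃ s v', zip (h - w.length) [] (w.map some) =
      zip (h - w.length) (([] : List (Alph M)).map some) (s :: (v' : List (Alph M)).map some) ∧
        v'.length ≤ D := by
    cases hw' : w with
    | nil => exact ⟨none, [], (zip_none_right ..).symm, by simp⟩
    | cons a w' => exact ⟨some a, w', rfl, by rw [← hwl, hw']; simp⟩
  obtain ⟨t, ht, d3⟩ := Prog.det_clean (m := mark) (T := T₂) (i := .depth) (w := []) (v := v')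
    (s := s) (h := h - w.length) (by simpa [hT₂, hT₁] using hsv.1)
  set T₃ := Function.update T₂ .depth t with hT₃
  have d4 := Prog.det_add (T := T₃) (i := .scale) (j := .den) (c := true) (enc := .inl)
    (dec := bitOf (M := M)) rfl (fun _ => rfl) (by simp) (w := (unary m).map .inl) (u := v)
    (h := 0) (h' := 0)
    (by simpa [hT₁, hT₂, hT₃, -List.map_map] using hscale)
    (by simpa [hT₁, hT₂, hT₃, -List.map_map] using hden)
  have hml : ((unary m).map (.inl : Bool → Alph M)).length = m := by simp [unary]
  rw [hml] at d4
  rw [hwl] at d1 d2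
  set T₄ := Function.update T₃ .den (wordTape M (Prog.sumOnes m true v)) with hT₄
  obtain ⟨T', d5, hk, hb, -⟩ := det_cleanAll (T := T₄) (n := n) l (by
    intro i
    simpa [hT₁, hT₂, hT₃, hT₄] using hsim i)
  refine ⟨T', _, d1.seq (d2.seq (d3.seq (d4.seq d5))), ?_,
    ⟨?_, ?_, ?_, ?_, ?_, fun i => hb i (hl i)⟩, fun c => ?_⟩
  · have c1 := Prog.count_sumOnes D false u
    have c2 := Prog.count_sumOnes m true v
    have := hsv.2
    simp only [settleCost, potential, List.length_nil]
    omega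
  · rw [hk _ (by simp)]; simpa [hT₁, hT₂, hT₃, hT₄] using hinp
  · rw [hk _ (by simp)]; simpa [hT₁, hT₂, hT₃, hT₄] using hscale
  · rw [hk _ (by simp)]; simp [hT₁, hT₂, hT₃, hT₄, hwl]
  · rw [hk _ (by simp)]; simp [hT₁, hT₂, hT₃, hT₄]
  · rw [hk _ (by simp)]; simpa [hT₁, hT₂, hT₃, hT₄] using ht
  · rw [hk _ (by simp)]; simp [hT₁, hT₂, hT₃, hT₄]

/-- After a round, the budget is what it was before, less the amortized cost of the round. -/
theorem wp_round (hbin : M.IsBinary) {l : List M.TapeIdx} (hl : ∀ i, i ∈ l) {x : List Bool}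
    {P m : ℕ} (hP : HaltsFrom M (M.init ![x]) P) {u v : List Bool}
    {T : Conf (Tp M.TapeIdx) (Alph M)} (hT : Home x m u v T)
    {post : Prog.Post (Tp M.TapeIdx) (Alph M)} {t : ℕ} {κ : ℕ → PMF ℕ}
    (hpost : ∀ D T', Home x m (Prog.sumOnes D false u) (Prog.sumOnes m true v) T' →
      (∀ c, T' (.ctr c) = T (.ctr c)) →
      post T' (t + potential (Prog.sumOnes D false u) (Prog.sumOnes m true v)) (κ D)) :
    (round M hbin l).Start post T (t + roundCost l.length x.length P m + potential u v)
      ((branchings M P (M.init ![x])).bind κ) := by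
  obtain ⟨h, h0⟩ := hT.sim (.inl 0)
  have d1 := Prog.det_copy (g := toSim M) (T := T) (i := .input) (j := .sim (.inl 0)) (by simp)
    hT.input h0
  set T₁ := Function.update T (.sim (.inl 0))
    (zip h [] (((x.map (.inl : Bool → Alph M)).map (toSim M)).map some)) with hT₁
  have hT₁ne : ∀ k, k ≠ .sim (.inl 0) → T₁ k = T k := fun k hk => Function.update_of_ne hk _ _
  have hrep : ∀ i, Represents (T₁ (.sim i)) (tapes (M.init ![x]) i) x.length := fun i =>
    represents_init x i hT.sim h
  simp only [List.length_map] at d1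
  have hdep : ∃ h, T₁ .depth = zip h ((List.replicate 0 (mark (M := M))).map some) [] := by
    rw [hT₁ne _ (by simp)]
    exact hT.depth
  have main := wp_simulate hbin (post := (settle M l).Start post) P hP hrep hdep (κ := κ)
    (t := t + settleCost l.length (x.length + P) P m + potential u v) ?_
  · simp only [zero_add] at main
    exact (Prog.start_seq (d1 _ _ _ (Prog.start_seq main))).mono (by simp only [roundCost]; omega)
  intro D T₂ hD hk hr hd
  rw [zero_add] at hd ⊢
  have hk' : ∀ k : Tp M.TapeIdx, k.Untouched → k ≠ .sim (.inl 0) → T₂ k = T k :=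
    fun k h1 h2 => (hk k h1).trans (hT₁ne k h2)
  obtain ⟨T', N, hdet, hN, hhome, hctr⟩ := det_settle hl hD (T := T₂)
    ((hk' .input trivial (by simp)).trans hT.input) ((hk' .scale trivial (by simp)).trans hT.scale)
    ((hk' .num trivial (by simp)).trans hT.num) ((hk' .den trivial (by simp)).trans hT.den) hd hr
  exact (hdet _ _ _ (hpost D T' hhome fun c =>
    (hctr c).trans (hk' (.ctr c) trivial (by simp)))).mono (by omega)

end

/-! ### The loops of the sampling machine -/

section

/-- The distribution of the final value if one sample `2 ^ D - 1`, `D` distributed according to `ν`,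
is added to the current sum and `κ` describes what happens then. -/
noncomputable def addSample (ν : PMF ℕ) (κ : ℕ → PMF ℕ) (S : ℕ) : PMF ℕ :=
  ν.bind fun D => κ (S + (2 ^ D - 1))

variable {M : NTM 1 0}

/-- The tape contents between two rounds, when the sum of the samples is `S`, there have been `R`
samples, and the propagation of carries needs at most the time `b` in advance. -/
def Account (x : List Bool) (m S R b : ℕ) (T : Conf (Tp M.TapeIdx) (Alph M)) : Prop :=
  ∃ u v, Home x m u v T ∧ NTM.binVal u = S ∧ NTM.binVal v = R * 2 ^ m ∧ potential u v ≤ b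

theorem Account.congr {x : List Bool} {m S R b : ℕ} {T T' : Conf (Tp M.TapeIdx) (Alph M)}
    (h : Account x m S R b T) (hT : ∀ k, (∀ c, k ≠ .ctr c) → T' k = T k) :
    Account x m S R b T' := by
  obtain ⟨u, v, hh, h1, h2, h3⟩ := h
  refine ⟨u, v, ⟨?_, ?_, ?_, ?_, ?_, fun i => ?_⟩, h1, h2, h3⟩
  all_goals rw [hT _ (by simp)]
  exacts [hh.input, hh.scale, hh.num, hh.den, hh.depth, hh.sim i]

/-- The fragment `p` performs `r` rounds in amortized time `C`, provided that the loop counters in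
`s` are in their home position, where they show the words given by `w`; all loop counters are
restored. -/
def Performs (x : List Bool) (m : ℕ) (ν : PMF ℕ) (w : Fin 3 → List (Alph M))
    (p : Prog (Tp M.TapeIdx) (Alph M)) (r C : ℕ) (s : Set (Fin 3)) : Prop :=
  ∀ (T : Conf (Tp M.TapeIdx) (Alph M)) (S R b t : ℕ) (post : Prog.Post (Tp M.TapeIdx) (Alph M))
    (κ : ℕ → PMF ℕ), Account x m S R b T →
    (∀ c ∈ s, T (.ctr c) = zip 0 [] ((w c).map some)) →
    (∀ T' S' b', Account x m S' (R + r) b' T' → (∀ c, T' (.ctr c) = T (.ctr c)) →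
      post T' (t + b') (κ S')) →
    p.Start post T (t + C + b) ((addSample ν)^[r] κ S)

variable {x : List Bool} {m : ℕ} {ν : PMF ℕ} {w : Fin 3 → List (Alph M)}

theorem performs_round (hbin : M.IsBinary) {l : List M.TapeIdx} (hl : ∀ i, i ∈ l) {P : ℕ}
    (hP : HaltsFrom M (M.init ![x]) P) :
    Performs x m (branchings M P (M.init ![x])) w (round M hbin l) 1
      (roundCost l.length x.length P m) ∅ := by
  rintro T S R b t post κ ⟨u, v, hh, h1, h2, h3⟩ - hpost
  refine (wp_round hbin hl hP hh (t := t) (κ := fun D => κ (S + (2 ^ D - 1))) ?_).mono (by omega)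
  intro D T' hT' hc
  refine hpost T' _ _ ⟨_, _, hT', ?_, ?_, le_rfl⟩ hc
  · have := Prog.binVal_sumOnes D false u
    have h2 := Nat.one_le_two_pow (n := D)
    simp only [Bool.toNat_false] at this
    omega
  · have := Prog.binVal_sumOnes m true v
    simp only [Bool.toNat_true] at this
    rw [add_mul]
    omega

theorem Performs.seq {p q : Prog (Tp M.TapeIdx) (Alph M)} {r C r' C' : ℕ} {s s' : Set (Fin 3)}
    (hp : Performs x m ν w p r C s) (hq : Performs x m ν w q r' C' s') :
    Performs x m ν w (p.seq q) (r + r') (C + C') (s ∪ s') := by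
  intro T S R b t post κ hT hs hpost
  rw [Function.iterate_add_apply]
  refine Prog.start_seq ((hp T S R b (t + C') _ _ hT (fun c hc => hs c (.inl hc)) ?_).mono
    (by omega))
  intro T' S' b' hT' hc
  refine hq T' S' (R + r) b' t post κ hT' (fun c hc' => (hc c).trans (hs c (.inr hc'))) ?_
  intro T'' S'' b'' hT'' hc'
  exact hpost T'' S'' b'' (by rwa [← add_assoc]) fun c => (hc' c).trans (hc c)

/-- Repeat `p` as often as indicated by the unary loop counter `i`. -/
noncomputable def counterLoop (i : Fin 3) (p : Prog (Tp M.TapeIdx) (Alph M)) :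
    Prog (Tp M.TapeIdx) (Alph M) :=
  (Prog.loop (.ctr i) (p.seq (Prog.on (.ctr i) fun s => (s, .right)))).seq (Prog.rewind (.ctr i))

/-- The loop from the moment on when the word `v` lies to the right of the head of the counter. -/
theorem Performs.loop_aux {p : Prog (Tp M.TapeIdx) (Alph M)} {r C : ℕ} {s : Set (Fin 3)}
    {i : Fin 3} (hp : Performs x m ν w p r C s) (hi : i ∉ s)
    {post : Prog.Post (Tp M.TapeIdx) (Alph M)} {κ : ℕ → PMF ℕ} {t : ℕ} (v : List (Alph M)) :
    ∀ {T : Conf (Tp M.TapeIdx) (Alph M)} {S R b h l}, Account x m S R b T →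
    (∀ c ∈ s, T (.ctr c) = zip 0 [] ((w c).map some)) → T (.ctr i) = zip h l (v.map some) →
    (∀ T' S' b', Account x m S' (R + v.length * r) b' T' →
      T' (.ctr i) = zip (h + v.length) ((v.map some).reverse ++ l) [] →
      (∀ c, c ≠ i → T' (.ctr c) = T (.ctr c)) → post T' (t + b') (κ S')) →
    (Prog.loop (.ctr i) (p.seq (Prog.on (.ctr i) fun s => (s, .right)))).Start post T
      (t + (v.length * (C + 3) + 1) + b) ((addSample ν)^[v.length * r] κ S) := by
  induction v with
  | nil =>
    intro T S R b h l hT _ hTi hpost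
    refine (Prog.start_loop_exit (t := t + b) (by simp [hTi]) ?_).mono (by simp)
    simpa using hpost T S b (by simpa using hT) (by simpa using hTi) (fun _ _ => rfl)
  | cons a v ih =>
    intro T S R b h l hT hs hTi hpost
    rw [List.length_cons, show (v.length + 1) * r = r + v.length * r by ring,
      Function.iterate_add_apply]
    refine (Prog.start_loop_enter (t := t + (v.length * (C + 3) + 1) + 1 + C + b)
      (by simp [hTi]) (Prog.start_seq (hp T S R b _ _ _ hT hs ?_))).mono (by
        rw [add_mul]; omega)
    intro T' S' b' hT' hc
    have hTi' := (hc i).trans hTi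
    have h1 := Prog.det_on (T := T') (.ctr i) fun s => (s, .right)
    rw [hTi', List.map_cons, read_zip_cons, move_right] at h1
    refine Prog.Wp.mono (h1 _ (t + (v.length * (C + 3) + 1) + b') _
      (ih (R := R + r) ?_ ?_ (Function.update_self ..) ?_)) (by omega)
    · exact hT'.congr fun k hk => Function.update_of_ne (hk i) _ _
    · intro c hc'
      rw [Function.update_of_ne (by simpa using fun h : c = i => hi (h ▸ hc')), hc, hs c hc']
    · intro T'' S'' b'' hT'' hi'' hc''
      refine hpost T'' S'' b'' ?_ ?_ ?_
      · convert hT'' using 1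
        rw [List.length_cons]; ring
      · rw [hi'']
        congr 1
        · push_cast [List.length_cons]; ring
        · simp
      · intro c hci
        rw [hc'' c hci, Function.update_of_ne (by simpa using hci), hc]

theorem Performs.loop {p : Prog (Tp M.TapeIdx) (Alph M)} {r C N : ℕ} {s : Set (Fin 3)}
    {i : Fin 3} (hp : Performs x m ν w p r C s) (hi : i ∉ s) (hN : (w i).length = N) :
    Performs x m ν w (counterLoop i p) (N * r) (N * (C + 5) + 4) (insert i s) := by
  intro T S R b t post κ hT hs hpost
  subst hN
  have hTi := hs i (.inl rfl)
  refine Prog.start_seq ((Performs.loop_aux hp hi (t := t + (2 * (w i).length + 3)) (w i) hT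
    (fun c hc => hs c (.inr hc)) hTi ?_).mono (by simp only [mul_add]; omega))
  intro T' S' b' hT' hi' hc'
  have h1 := Prog.det_rewind (T := T') (i := .ctr i) (w i).reverse (by simpa using hi')
  refine Prog.Wp.mono (h1 _ (t + b') _ (hpost _ S' b' ?_ ?_)) (by simp; omega)
  · exact hT'.congr fun k hk => Function.update_of_ne (hk i) _ _
  · intro c
    by_cases hci : c = i
    · subst hci
      rw [Function.update_self, hTi]
      simp
    · rw [Function.update_of_ne (by simpa using hci), hc' c hci]

/-- The sampling machine: if the counters `2` and `0` show the unary numbers `k` and `d`, perform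
`k * (k * (1 + d))` rounds. -/
noncomputable def sampler (M : NTM 1 0) (hbin : M.IsBinary) (l : List M.TapeIdx) :
    Prog (Tp M.TapeIdx) (Alph M) :=
  (Prog.copy id (.ctr 2) (.ctr 1)).seq <| counterLoop 2 <| counterLoop 1 <|
    (round M hbin l).seq <| counterLoop 0 <| round M hbin l

/-- The running time of the sampling machine, if a round takes time `C`. -/
def samplerCost (k d C : ℕ) : ℕ :=
  (6 * k + 7) + (k * ((k * (C + (d * (C + 5) + 4) + 5) + 4) + 5) + 4)

/-- The initial tape contents of the sampling machine. -/
def samplerInit (M : NTM 1 0) (x : List Bool) (k d m : ℕ) : Conf (Tp M.TapeIdx) (Alph M)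
  | .input => wordTape M x
  | .scale => wordTape M (unary m)
  | .ctr 2 => wordTape M (unary k)
  | .ctr 0 => wordTape M (unary d)
  | _ => wordTape M []

/-- The sum shown at the end by the sampling machine is a sum of `k * (k * (1 + d))` independent
samples. -/
theorem wp_sampler (hbin : M.IsBinary) {l : List M.TapeIdx} (hl : ∀ i, i ∈ l) {P : ℕ}
    (hP : HaltsFrom M (M.init ![x]) P) (k d : ℕ) :
    (sampler M hbin l).Start
      (fun T _ μ => ∃ S b, μ = PMF.pure S ∧ Account x m S (k * (k * (1 + d))) b T)
      (samplerInit M x k d m) (samplerCost k d (roundCost l.length x.length P m))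
      ((addSample (branchings M P (M.init ![x])))^[k * (k * (1 + d))] PMF.pure 0) := by
  set C := roundCost l.length x.length P m with hC
  have hr := performs_round (m := m) (x := x) (l := l)
    (w := ![(unary d).map .inl, (unary k).map .inl, (unary k).map .inl]) hbin hl hP
  have h0 := hr.loop (i := 0) (N := d) (by simp) (by simp [unary])
  have h1 := (hr.seq h0).loop (i := 1) (N := k) (by simp) (by simp [unary])
  have h2 := h1.loop (i := 2) (N := k) (by simp) (by simp [unary])
  rw [mul_one] at h2
  have hcopy := Prog.det_copy (g := id) (T := samplerInit M x k d m) (i := .ctr 2) (j := .ctr 1)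
    (w := (unary k).map .inl) (h := 0) (h' := 0) (by simp) rfl rfl
  rw [List.map_id, show ((unary k).map (.inl : Bool → Alph M)).length = k by simp [unary]] at hcopy
  refine Prog.start_seq ((hcopy _ _ _ (h2 _ 0 0 0 0 _ PMF.pure ?_ ?_ ?_)).mono ?_)
  · refine ⟨[], [], ⟨?_, ?_, ?_, ?_, ?_, fun i => ?_⟩, rfl, by simp [NTM.binVal],
      by simp [potential]⟩
    all_goals rw [Function.update_of_ne (by simp)]
    exacts [rfl, rfl, rfl, rfl, ⟨0, rfl⟩, ⟨0, rfl⟩]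
  · intro c _
    fin_cases c
    · exact Function.update_of_ne (by simp) _ _
    · exact Function.update_self ..
    · exact Function.update_of_ne (by simp) _ _
  · intro T' S' b' hT' _
    exact ⟨S', b', rfl, by simpa using hT'⟩
  · simp only [samplerCost, ← hC]
    omega

end

open MeasureTheory ProbabilityTheory
open scoped ENNReal

/-! ### The mean of a sample -/

section leaves

variable {a b : ℕ} {M : NTM a b}

/-- The complete computations starting at `c`. -/
def paths (M : NTM a b) (c : M.Cfg) : Set (List ℕ) := {w | ∃ k c', M.Run c w k c' ∧ M.Halted c'}

theorem mem_paths_nil {c : M.Cfg} : [] ∈ paths M c ↔ M.succs c = [] := by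
  constructor
  · rintro ⟨k, c', hr, hh⟩
    cases hr
    exact hh
  · exact fun h => ⟨0, c, .refl c, h⟩

theorem mem_paths_cons {c : M.Cfg} {i : ℕ} {w : List ℕ} :
    i :: w ∈ paths M c ↔ ∃ c', (M.succs c)[i]? = some c' ∧ w ∈ paths M c' := by
  constructor
  · rintro ⟨k, c', hr, hh⟩
    cases hr with
    | step h hr => exact ⟨_, h, _, _, hr, hh⟩
  · rintro ⟨c', h, k, c'', hr, hh⟩
    exact ⟨_, c'', .step h hr, hh⟩

theorem tsum_mix (μ₀ μ₁ : PMF ℕ) (g : ℕ → ℝ≥0∞) :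
    2 * ∑' D, mix μ₀ μ₁ D * g D = ∑' D, μ₀ D * g D + ∑' D, μ₁ D * g D := by
  have h : ∀ D, mix μ₀ μ₁ D = 2⁻¹ * μ₀ D + 2⁻¹ * μ₁ D := by
    intro D
    simp [mix, PMF.bind_apply, tsum_fintype, add_comm]
  simp_rw [h, add_mul, mul_assoc]
  rw [ENNReal.tsum_add, ENNReal.tsum_mul_left, ENNReal.tsum_mul_left, ← mul_add, ← mul_assoc,
    ENNReal.mul_inv_cancel (by simp) (by simp), one_mul]

theorem tsum_bind (ν : PMF ℕ) (κ : ℕ → PMF ℕ) (g : ℕ → ℝ≥0∞) :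
    ∑' s, (ν.bind κ) s * g s = ∑' D, ν D * ∑' s, κ D s * g s := by
  simp_rw [PMF.bind_apply, ← ENNReal.tsum_mul_right, ← ENNReal.tsum_mul_left]
  rw [ENNReal.tsum_comm]
  simp_rw [mul_assoc]

theorem tsum_pure (s : ℕ) (g : ℕ → ℝ≥0∞) : ∑' D, PMF.pure s D * g D = g s := by
  rw [tsum_eq_single s]
  · simp
  · intro D hD
    simp [hD]

/-- A complete computation with `D` nondeterministic steps is taken with probability `2⁻ᴰ`.
Therefore the mean of `2 ^ D` is the number of computation paths. -/
theorem tsum_branchings (hbin : M.IsBinary) (n : ℕ) : ∀ c, HaltsFrom M c n →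
    (paths M c).Finite ∧ ∑' D, branchings M n c D * 2 ^ D = (paths M c).ncard := by
  have halt : ∀ {c : M.Cfg}, M.succs c = [] → paths M c = {[]} := by
    intro c hc
    ext w
    cases w with
    | nil => simp [mem_paths_nil, hc]
    | cons i w => simp [mem_paths_cons, hc]
  induction n with
  | zero =>
    intro c hc
    rw [halt hc.succs_eq_nil, branchings, tsum_pure]
    simp
  | succ n ih =>
    intro c hc
    have hlen : (M.succs c).length ≤ 2 := by simpa [NTM.succs] using hbin _ _
    match hs : M.succs c, hlen with
    | [], _ =>
      rw [halt hs, branchings, hs, tsum_pure]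
      simp
    | [c₀], _ =>
      have h0 := ih c₀ (hc.succ (i := 0) (by simp [hs]))
      have hp : paths M c = List.cons 0 '' paths M c₀ := by
        ext w
        cases w with
        | nil => simp [mem_paths_nil, hs]
        | cons i w => cases i <;> simp [mem_paths_cons, hs]
      rw [hp, branchings, hs, Set.ncard_image_of_injective _ (List.cons_injective)]
      exact ⟨h0.1.image _, h0.2⟩
    | [c₀, c₁], _ =>
      have h0 := ih c₀ (hc.succ (i := 0) (by simp [hs]))
      have h1 := ih c₁ (hc.succ (i := 1) (by simp [hs]))
      have hp : paths M c = List.cons 0 '' paths M c₀ ∪ List.cons 1 '' paths M c₁ := by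
        ext w
        cases w with
        | nil => simp [mem_paths_nil, hs]
        | cons i w => rcases i with _ | _ | i <;> simp [mem_paths_cons, hs]
      refine ⟨hp ▸ (h0.1.image _).union (h1.1.image _), ?_⟩
      rw [hp, Set.ncard_union_eq ?_ (h0.1.image _) (h1.1.image _),
        Set.ncard_image_of_injective _ (List.cons_injective),
        Set.ncard_image_of_injective _ (List.cons_injective), branchings, hs]
      · push_cast
        rw [← h0.2, ← h1.2, ← tsum_mix]
        simp only [PMF.map, tsum_bind, Function.comp_def, tsum_pure, pow_succ]
        rw [← ENNReal.tsum_mul_left]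
        congr 1
        funext D
        ring
      · rw [Set.disjoint_left]
        rintro _ ⟨w, -, rfl⟩ ⟨w', -, h⟩
        simp at h

theorem run_of_mem_support (hbin : M.IsBinary) (n : ℕ) : ∀ {c : M.Cfg} {D : ℕ},
    D ∈ (branchings M n c).support → ∃ w c', M.Run c w D c' := by
  induction n with
  | zero =>
    intro c D hD
    obtain rfl : D = 0 := by simpa [branchings] using hD
    exact ⟨[], c, .refl c⟩
  | succ n ih =>
    intro c D hD
    have hlen : (M.succs c).length ≤ 2 := by simpa [NTM.succs] using hbin _ _
    match hs : M.succs c, hlen with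
    | [], _ =>
      rw [branchings, hs] at hD
      obtain rfl : D = 0 := by simpa using hD
      exact ⟨[], c, .refl c⟩
    | [c₀], _ =>
      rw [branchings, hs] at hD
      obtain ⟨w, c', hr⟩ := ih hD
      exact ⟨0 :: w, c', by simpa [hs] using NTM.Run.step (c := c) (i := 0) (by simp [hs]) hr⟩
    | [c₀, c₁], _ =>
      rw [branchings, hs] at hD
      obtain ⟨D', hD', rfl⟩ : ∃ D', D' ∈ (mix (branchings M n c₀) (branchings M n c₁)).support ∧
          D' + 1 = D := by
        obtain ⟨D', h, h'⟩ := (PMF.mem_support_map_iff _ _ _).1 hD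
        exact ⟨D', h, h'⟩
      obtain ⟨e, -, he⟩ := (PMF.mem_support_bind_iff _ _ _).1 hD'
      cases e with
      | false =>
        obtain ⟨w, c', hr⟩ := ih he
        exact ⟨0 :: w, c', by simpa [hs] using NTM.Run.step (c := c) (i := 0) (by simp [hs]) hr⟩
      | true =>
        obtain ⟨w, c', hr⟩ := ih he
        exact ⟨1 :: w, c', by simpa [hs] using NTM.Run.step (c := c) (i := 1) (by simp [hs]) hr⟩

theorem le_length_of_run {c c' : M.Cfg} {w : List ℕ} {k : ℕ} (h : M.Run c w k c') :
    k ≤ w.length := by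
  induction h with
  | refl => simp
  | step h hr ih =>
    simp only [List.length_cons]
    split_ifs <;> omega

theorem le_ndBits {inp : Fin a → List Bool} {w : List ℕ} {k n : ℕ} {c : M.Cfg}
    (hn : HaltsFrom M (M.init inp) n) (h : M.Run (M.init inp) w k c) : k ≤ M.ndBits inp := by
  refine le_csSup ⟨n, ?_⟩ ⟨w, c, h⟩
  rintro k ⟨w, c, h⟩
  exact (le_length_of_run h).trans (hn _ _ _ h)

end leaves

/-! ### Hoeffding's inequality for the sum of the samples -/

section hoeffding

/-- The moment generating function of a bounded random variable (Hoeffding's lemma). -/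
theorem tsum_exp_le (ν : PMF ℕ) (X : ℕ → ℝ) (B E : ℝ) (hX : ∀ D ∈ ν.support, X D ∈ Set.Icc 0 B)
    (hE : ∫ D, X D ∂ν.toMeasure = E) (t : ℝ) :
    ∑' D, ν D * ENNReal.ofReal (Real.exp (t * (X D - E))) ≤
      ENNReal.ofReal (Real.exp (B ^ 2 * t ^ 2 / 8)) := by
  have hae : ∀ᵐ D ∂ν.toMeasure, X D ∈ Set.Icc 0 B := by
    rw [ae_iff, PMF.toMeasure_apply_eq_zero_iff _ (by measurability), Set.disjoint_left]
    exact fun D hD h => h (hX D hD)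
  have h := hasSubgaussianMGF_of_mem_Icc (X := X) (μ := ν.toMeasure) (a := 0) (b := B)
    (by fun_prop) hae
  have h1 := h.mgf_le t
  have h2 := h.integrable_exp_mul t
  rw [mgf, hE] at h1
  rw [hE] at h2
  have h3 := ofReal_integral_eq_lintegral_ofReal h2 (ae_of_all _ fun D => (Real.exp_pos _).le)
  rw [lintegral_countable'] at h3
  simp_rw [PMF.toMeasure_apply_singleton _ _ (measurableSet_singleton _), mul_comm _ (ν _)] at h3
  rw [← h3]
  refine ENNReal.ofReal_le_ofReal (h1.trans (Real.exp_le_exp.2 (le_of_eq ?_)))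
  push_cast
  simp only [sub_zero, Real.norm_eq_abs, div_pow, sq_abs]
  ring

variable {ν : PMF ℕ} {B E : ℝ}

/-- The samples are independent, so that the moment generating functions are multiplied. -/
theorem tsum_exp_sum_le (hX : ∀ D ∈ ν.support, (2 ^ D - 1 : ℝ) ∈ Set.Icc 0 B)
    (hE : ∫ D, (2 ^ D - 1 : ℝ) ∂ν.toMeasure = E) (t : ℝ) (r : ℕ) : ∀ S : ℕ,
    ∑' s, ((addSample ν)^[r] PMF.pure S) s *
        ENNReal.ofReal (Real.exp (t * ((s : ℝ) - S - r * E))) ≤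
      ENNReal.ofReal (Real.exp (r * (B ^ 2 * t ^ 2 / 8))) := by
  induction r with
  | zero =>
    intro S
    rw [Function.iterate_zero, id, tsum_pure]
    simp
  | succ r ih =>
    intro S
    rw [Function.iterate_succ_apply', addSample, tsum_bind]
    have key : ∀ D s : ℕ, ENNReal.ofReal (Real.exp (t * ((s : ℝ) - S - (r + 1 : ℕ) * E))) =
        ENNReal.ofReal (Real.exp (t * ((2 ^ D - 1 : ℝ) - E))) *
        ENNReal.ofReal (Real.exp (t * ((s : ℝ) - (S + (2 ^ D - 1) : ℕ) - r * E))) := by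
      intro D s
      rw [← ENNReal.ofReal_mul (Real.exp_pos _).le, ← Real.exp_add]
      congr 2
      push_cast [Nat.one_le_two_pow]
      ring
    calc _ ≤ ∑' D, ν D * (ENNReal.ofReal (Real.exp (t * ((2 ^ D - 1 : ℝ) - E))) *
          ENNReal.ofReal (Real.exp (r * (B ^ 2 * t ^ 2 / 8)))) := by
          refine ENNReal.tsum_le_tsum fun D => mul_le_mul_right ?_ _
          simp_rw [key D, mul_left_comm _ (ENNReal.ofReal (Real.exp (t * ((2 ^ D - 1 : ℝ) - E))))]
          rw [ENNReal.tsum_mul_left]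
          exact mul_le_mul_right (ih _) _
      _ ≤ ENNReal.ofReal (Real.exp (B ^ 2 * t ^ 2 / 8)) *
          ENNReal.ofReal (Real.exp (r * (B ^ 2 * t ^ 2 / 8))) := by
          simp_rw [← mul_assoc]
          rw [ENNReal.tsum_mul_right]
          exact mul_le_mul_left (tsum_exp_le ν _ B E hX hE t) _
      _ = _ := by
          rw [← ENNReal.ofReal_mul (Real.exp_pos _).le, ← Real.exp_add]
          congr 2
          push_cast
          ring

/-- Chernoff's bound for the sum of `r` samples, for both tails, depending on the sign of `t`. -/
theorem chernoff (hX : ∀ D ∈ ν.support, (2 ^ D - 1 : ℝ) ∈ Set.Icc 0 B)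
    (hE : ∫ D, (2 ^ D - 1 : ℝ) ∂ν.toMeasure = E) (t : ℝ) (r : ℕ) (y : ℝ) :
    ((addSample ν)^[r] PMF.pure 0).toOuterMeasure {s | y ≤ t * ((s : ℝ) - r * E)} ≤
      ENNReal.ofReal (Real.exp (r * (B ^ 2 * t ^ 2 / 8) - y)) := by
  rw [PMF.toOuterMeasure_apply, sub_eq_add_neg, Real.exp_add,
    ENNReal.ofReal_mul (Real.exp_pos _).le]
  refine le_trans ?_ (mul_le_mul_left (tsum_exp_sum_le hX hE t r 0) _)
  rw [← ENNReal.tsum_mul_right]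
  refine ENNReal.tsum_le_tsum fun s => ?_
  rw [Set.indicator_apply]
  split_ifs with hs
  swap
  · exact zero_le
  rw [mul_assoc, ← ENNReal.ofReal_mul (Real.exp_pos _).le, ← Real.exp_add]
  refine le_mul_of_one_le_right (by simp) (ENNReal.one_le_ofReal.2 (Real.one_le_exp ?_))
  simp only [Set.mem_ofPred_eq] at hs
  push_cast
  linarith

/-- The accuracy of the mean of `k * (k * (1 + d))` samples. -/
theorem accuracy (hX : ∀ D ∈ ν.support, (2 ^ D - 1 : ℝ) ∈ Set.Icc 0 B) (hB : 0 < B)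
    (hE : ∫ D, (2 ^ D - 1 : ℝ) ∂ν.toMeasure = E) {ξ δ : ℝ} (hξ : 0 < ξ) (hδ : 0 < δ) {k d r : ℕ}
    (hk : 1 / ξ ≤ k) (hd : Real.logb 2 (1 / δ) ≤ d) (hr : r = k * (k * (1 + d))) :
    ENNReal.ofReal (1 - δ) ≤ ((addSample ν)^[r] PMF.pure 0).toOuterMeasure
      {s | |(s : ℝ) / r - E| ≤ ξ * B} := by
  set μ := (addSample ν)^[r] PMF.pure 0 with hμ
  have hk0 : (0 : ℝ) < k := (one_div_pos.2 hξ).trans_le hk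
  have hr0 : (0 : ℝ) < r := by
    rw [hr]
    push_cast
    positivity
  have hkξ : 1 ≤ k * ξ := by rwa [div_le_iff₀ hξ] at hk
  have hrξ : (1 + d : ℝ) ≤ r * ξ ^ 2 := by
    rw [hr]
    push_cast
    have : (1 : ℝ) ≤ (k * ξ) ^ 2 := one_le_pow₀ hkξ
    have h2 := mul_le_mul_of_nonneg_left this (by positivity : (0 : ℝ) ≤ 1 + d)
    linarith
  have hexp : 2 * Real.exp (-(2 * (r * ξ ^ 2))) ≤ δ := by
    have h1 : Real.exp (-1) ≤ 2⁻¹ := by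
      rw [Real.exp_neg]
      refine inv_anti₀ (by norm_num) ?_
      have := Real.add_one_le_exp 1
      linarith
    have h2 : (2 : ℝ)⁻¹ ^ d ≤ δ := by
      rw [Real.logb_le_iff_le_rpow (by norm_num) (by positivity), Real.rpow_natCast] at hd
      rw [inv_pow]
      exact inv_le_of_inv_le₀ hδ (by rwa [one_div] at hd)
    calc 2 * Real.exp (-(2 * (r * ξ ^ 2))) ≤ 2 * Real.exp (((1 + d : ℕ) : ℝ) * (-1)) := by
          gcongr
          push_cast
          linarith [(Nat.cast_nonneg d : (0 : ℝ) ≤ d)]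
      _ = 2 * Real.exp (-1) ^ (1 + d) := by rw [Real.exp_nat_mul]
      _ ≤ 2 * 2⁻¹ ^ (1 + d) := by gcongr
      _ = 2⁻¹ ^ d := by rw [pow_add]; ring
      _ ≤ δ := h2
  -- The parameter of Chernoff's bound that minimizes the exponent is `4 * ξ / B`.
  have tail : ∀ σ : ℝ, σ ^ 2 = 1 →
      μ.toOuterMeasure {s | 4 * ξ / B * (r * (ξ * B)) ≤ σ * (4 * ξ / B) * ((s : ℝ) - r * E)} ≤
        ENNReal.ofReal (Real.exp (-(2 * (r * ξ ^ 2)))) := by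
    intro σ hσ
    refine (chernoff hX hE _ r _).trans (le_of_eq ?_)
    congr 2
    rw [mul_pow, hσ]
    field_simp
    ring
  set good := {s : ℕ | |(s : ℝ) / r - E| ≤ ξ * B} with hgood
  have hbad : goodᶜ ⊆
      {s : ℕ | 4 * ξ / B * (r * (ξ * B)) ≤ 1 * (4 * ξ / B) * ((s : ℝ) - r * E)} ∪
      {s : ℕ | 4 * ξ / B * (r * (ξ * B)) ≤ -1 * (4 * ξ / B) * ((s : ℝ) - r * E)} := by
    intro s hs
    have hs' : ξ * B < |(s : ℝ) / r - E| := not_le.1 hs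
    have he : (s : ℝ) / r - E = ((s : ℝ) - r * E) / r := by field_simp
    have hpos : 0 < 4 * ξ / B := by positivity
    rw [he, abs_div, abs_of_pos hr0, lt_div_iff₀ hr0] at hs'
    rcases abs_cases ((s : ℝ) - r * E) with ⟨h, -⟩ | ⟨h, -⟩
    · left
      rw [h] at hs'
      show 4 * ξ / B * (r * (ξ * B)) ≤ 1 * (4 * ξ / B) * ((s : ℝ) - r * E)
      rw [one_mul]
      gcongr
      linarith
    · right
      rw [h] at hs'
      show 4 * ξ / B * (r * (ξ * B)) ≤ -1 * (4 * ξ / B) * ((s : ℝ) - r * E)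
      rw [show -1 * (4 * ξ / B) * ((s : ℝ) - r * E) = 4 * ξ / B * -((s : ℝ) - r * E) by ring]
      gcongr
      linarith
  have h1 : μ.toOuterMeasure goodᶜ ≤ ENNReal.ofReal δ := by
    refine ((measure_mono hbad).trans (measure_union_le _ _)).trans
      ((add_le_add (tail 1 (by norm_num)) (tail (-1) (by norm_num))).trans ?_)
    rw [← ENNReal.ofReal_add (Real.exp_pos _).le (Real.exp_pos _).le]
    exact ENNReal.ofReal_le_ofReal (by linarith)
  have h2 : (1 : ℝ≥0∞) ≤ μ.toOuterMeasure good + ENNReal.ofReal δ := by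
    calc (1 : ℝ≥0∞) = μ.toOuterMeasure (good ∪ goodᶜ) := by
          rw [Set.union_compl_self]
          exact ((PMF.toOuterMeasure_apply_eq_one_iff _ _).2 (Set.subset_univ _)).symm
      _ ≤ μ.toOuterMeasure good + μ.toOuterMeasure goodᶜ := measure_union_le _ _
      _ ≤ _ := by gcongr
  rw [ENNReal.ofReal_sub _ hδ.le, ENNReal.ofReal_one]
  exact tsub_le_iff_right.2 h2

end hoeffding

/-! ### From programs to machines -/

section compile

variable {ι Γ W : Type} {a b : ℕ}

/-- The machine that executes a program; `e` tells which tapes are input and output tapes. -/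
def Prog.toNTM (p : Prog ι Γ) (e : Fin a ⊕ Fin b ⊕ W ≃ ι) (hW : Finite W) (hΓ : Finite Γ)
    (bit : Bool ↪ Γ) : NTM a b where
  Work := W
  State := Option p.S
  Symb := Γ
  finite_work := hW
  finite_state := by have := p.fin; infer_instance
  finite_symb := hΓ
  bit := bit
  start := some p.entry
  trans s r := match s with
    | none => []
    | some s => (p.tr s (r ∘ e.symm)).map fun x => (x.1, x.2 ∘ e)

variable {p : Prog ι Γ} {e : Fin a ⊕ Fin b ⊕ W ≃ ι} {hW : Finite W} {hΓ : Finite Γ}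
  {bit : Bool ↪ Γ}

theorem isBinary_toNTM : (p.toNTM e hW hΓ bit).IsBinary := by
  rintro (_ | s) r
  · simp [Prog.toNTM]
  · simpa [Prog.toNTM] using p.bin s _

/-- The tape contents of a configuration. -/
def confOf (e : Fin a ⊕ Fin b ⊕ W ≃ ι) (c : (p.toNTM e hW hΓ bit).Cfg) : Conf ι Γ :=
  fun k => ⟨c.head (e.symm k), c.cells (e.symm k)⟩

theorem succs_toNTM {c : (p.toNTM e hW hΓ bit).Cfg} {s : p.S} (hs : c.state = some s) :
    ((p.toNTM e hW hΓ bit).succs c).map (fun c' => (c'.state, confOf e c')) =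
      p.next s (confOf e c) := by
  simp only [NTM.succs, hs, Prog.toNTM, List.map_map, Prog.next]
  refine List.map_congr_left fun x _ => ?_
  simp only [Function.comp_apply, Prod.mk.injEq]
  refine ⟨rfl, ?_⟩
  funext k
  simp [confOf, NTM.perform, Tape.act]

theorem toOuterMeasure_mix (μ₀ μ₁ : PMF ℕ) (A : Set ℕ) :
    (mix μ₀ μ₁).toOuterMeasure A = 2⁻¹ * μ₁.toOuterMeasure A + 2⁻¹ * μ₀.toOuterMeasure A := by
  rw [mix, PMF.toOuterMeasure_bind_apply, tsum_fintype]
  simp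

/-- What is known about a program is true for the machine that executes it. -/
theorem Prog.Wp.toNTM {post : Prog.Post ι Γ} {Q : Conf ι Γ → ℕ → Prop}
    (hpost : ∀ T t μ, post T t μ → ∃ S, μ = PMF.pure S ∧ Q T S) {s : Option p.S} {T : Conf ι Γ}
    {t : ℕ} {μ : PMF ℕ} (h : p.Wp post s T t μ) :
    ∀ c : (p.toNTM e hW hΓ bit).Cfg, c.state = s → confOf e c = T →
    HaltsFrom (p.toNTM e hW hΓ bit) c t ∧ ∀ A : Set ℕ, μ.toOuterMeasure A ≤
      ((p.toNTM e hW hΓ bit).dist t c).toOuterMeasure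
        {c' | (p.toNTM e hW hΓ bit).Halted c' ∧ ∃ S ∈ A, Q (confOf e c') S} := by
  induction h with
  | @exit T t t' μ h ht =>
    intro c hs hT
    have hc : (p.toNTM e hW hΓ bit).succs c = [] := by simp [NTM.succs, hs, Prog.toNTM]
    refine ⟨fun w k c' hr => ?_, fun A => ?_⟩
    · cases hr with
      | refl => simp
      | step h _ => simp [hc] at h
    · have hd : (p.toNTM e hW hΓ bit).dist t' c = PMF.pure c := by
        cases t' with
        | zero => rfl
        | succ t' => rw [NTM.dist, hc]
      obtain ⟨S, rfl, hQ⟩ := hpost _ _ _ h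
      classical
      rw [hd, PMF.toOuterMeasure_pure_apply, PMF.toOuterMeasure_pure_apply]
      by_cases hS : S ∈ A
      · rw [if_pos hS, if_pos]
        exact ⟨hc, S, hS, hT ▸ hQ⟩
      · rw [if_neg hS]
        exact zero_le
  | @det s T s' T' t μ h _ ih =>
    intro c hs hT
    have hn := succs_toNTM hs
    rw [hT, h] at hn
    obtain ⟨c', hc, hc'⟩ := List.map_eq_singleton_iff.1 hn
    obtain ⟨h1, h2⟩ := ih c' (congrArg Prod.fst hc') (congrArg Prod.snd hc')
    refine ⟨fun w k c'' hr => ?_, fun A => ?_⟩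
    · cases hr with
      | refl => simp
      | @step _ c₁ _ i w k h hr =>
        rw [hc] at h
        cases i with
        | zero =>
          obtain rfl : c' = c₁ := by simpa using h
          simpa using h1 _ _ _ hr
        | succ i => simp at h
    · rw [NTM.dist, hc]
      exact h2 A
  | @flip s T s₀ T₀ s₁ T₁ t μ₀ μ₁ h _ _ ih₀ ih₁ =>
    intro c hs hT
    have hn := succs_toNTM hs
    rw [hT, h] at hn
    obtain ⟨c₀, l, hc, hc₀, hl⟩ := List.map_eq_cons_iff.1 hn
    obtain ⟨c₁, rfl, hc₁⟩ := List.map_eq_singleton_iff.1 hl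
    obtain ⟨h1, h2⟩ := ih₀ c₀ (congrArg Prod.fst hc₀) (congrArg Prod.snd hc₀)
    obtain ⟨h3, h4⟩ := ih₁ c₁ (congrArg Prod.fst hc₁) (congrArg Prod.snd hc₁)
    refine ⟨fun w k c'' hr => ?_, fun A => ?_⟩
    · cases hr with
      | refl => simp
      | @step _ c' _ i w k h hr =>
        rw [hc] at h
        rcases i with _ | _ | i
        · obtain rfl : c₀ = c' := by simpa using h
          simpa using h1 _ _ _ hr
        · obtain rfl : c₁ = c' := by simpa using h
          simpa using h3 _ _ _ hr
        · simp at h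
    · rw [NTM.dist, hc, toOuterMeasure_mix]
      dsimp only
      rw [PMF.toOuterMeasure_bind_apply, tsum_fintype]
      simp only [Fintype.sum_bool, PMF.uniformOfFintype_apply, Fintype.card_bool, Nat.cast_ofNat,
        if_true, Bool.false_eq_true, if_false]
      gcongr
      · exact h4 A
      · exact h2 A

end compile

/-! ### Correctness and running time of the sampling machine -/

section mean

variable {M : NTM 1 0} {f : List Bool → ℕ}

theorem two_pow_sub_one_mem {x : List Bool} {P : ℕ} (hbin : M.IsBinary)
    (hP : HaltsFrom M (M.init ![x]) P) :
    ∀ D ∈ (branchings M P (M.init ![x])).support,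
      (2 ^ D - 1 : ℝ) ∈ Set.Icc 0 ((2 : ℝ) ^ M.ndBits ![x]) := by
  intro D hD
  obtain ⟨w, c, hr⟩ := run_of_mem_support hbin P hD
  have h1 : (1 : ℝ) ≤ 2 ^ D := one_le_pow₀ (by norm_num)
  have h2 : (2 : ℝ) ^ D ≤ 2 ^ M.ndBits ![x] :=
    pow_le_pow_right₀ (by norm_num) (le_ndBits hP hr)
  exact ⟨by linarith, by linarith⟩

/-- The mean of a sample is the number of paths, not counting one of them. -/
theorem integral_sample {x : List Bool} {P : ℕ} (hbin : M.IsBinary)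
    (hP : HaltsFrom M (M.init ![x]) P) (hf : M.numPaths ![x] = f x + 1) :
    ∫ D, (2 ^ D - 1 : ℝ) ∂(branchings M P (M.init ![x])).toMeasure = f x := by
  set ν := branchings M P (M.init ![x]) with hν
  have hint : Integrable (fun D : ℕ => (2 : ℝ) ^ D) ν.toMeasure := by
    refine Integrable.of_bound (by fun_prop) (2 ^ M.ndBits ![x] + 1) ?_
    rw [ae_iff, PMF.toMeasure_apply_eq_zero_iff _ (by measurability), Set.disjoint_left]
    intro D hD h
    have := (two_pow_sub_one_mem hbin hP D hD).2
    refine h ?_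
    rw [Real.norm_of_nonneg (by positivity)]
    linarith
  have htsum := (tsum_branchings hbin P _ hP).2
  change _ = ((M.numPaths ![x] : ℕ) : ℝ≥0∞) at htsum
  have h1 : ∫ D, (2 : ℝ) ^ D ∂ν.toMeasure = f x + 1 := by
    rw [integral_eq_lintegral_of_nonneg_ae (ae_of_all _ fun D => by positivity) (by fun_prop),
      lintegral_countable']
    simp_rw [PMF.toMeasure_apply_singleton _ _ (measurableSet_singleton _)]
    have : ∀ D : ℕ, ENNReal.ofReal ((2 : ℝ) ^ D) * ν D = ν D * 2 ^ D := by
      intro D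
      rw [ENNReal.ofReal_pow (by norm_num), ENNReal.ofReal_ofNat, mul_comm]
    simp_rw [this]
    rw [htsum, hf, ENNReal.toReal_natCast]
    push_cast
    rfl
  rw [integral_sub hint (integrable_const _), h1]
  simp

end mean

theorem eval_mono (p : Polynomial ℕ) {m n : ℕ} (h : m ≤ n) : p.eval m ≤ p.eval n := by
  rw [Polynomial.eval_eq_sum, Polynomial.eval_eq_sum]
  exact Finset.sum_le_sum fun i _ => Nat.mul_le_mul_left _ (Nat.pow_le_pow_left h i)

/-- The running time is polynomial, with an explicit factor `k ^ 2`. -/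
theorem samplerCost_le (p : Polynomial ℕ) (c : ℕ) : ∃ q : Polynomial ℕ, ∀ n k d m, 1 ≤ k →
    samplerCost k d (roundCost c n (p.eval n) m) ≤ k ^ 2 * q.eval (n + d + m) := by
  let C : Polynomial ℕ := 14 * .X + 15 * p + 48 + .C c * (4 * .X + 4 * p + 10)
  refine ⟨35 + C + .X * (C + 5), fun n k d m hk => ?_⟩
  set y := n + d + m with hy
  have hp := eval_mono p (show n ≤ y by omega)
  have hC : roundCost c n (p.eval n) m ≤ C.eval y := by
    have : c * (4 * (n + p.eval n) + 10) ≤ c * (4 * y + 4 * p.eval y + 10) :=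
      Nat.mul_le_mul_left _ (by omega)
    simp only [roundCost, settleCost, C, Polynomial.eval_add, Polynomial.eval_mul,
      Polynomial.eval_X, Polynomial.eval_C, Polynomial.eval_ofNat]
    omega
  set C₀ := roundCost c n (p.eval n) m
  simp only [samplerCost, Polynomial.eval_add, Polynomial.eval_mul, Polynomial.eval_X,
    Polynomial.eval_ofNat]
  set C₁ := C.eval y
  have h1 : d * (C₀ + 5) ≤ y * (C₁ + 5) := Nat.mul_le_mul (by omega) (by omega)
  have h2 : k ≤ k ^ 2 := Nat.le_self_pow (by norm_num) k
  have h3 : k ^ 2 * (C₀ + d * (C₀ + 5)) ≤ k ^ 2 * (C₁ + y * (C₁ + 5)) :=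
    Nat.mul_le_mul_left _ (by omega)
  nlinarith

section final

variable {M : NTM 1 0} {f : List Bool → ℕ} {a : ℕ} {W : Type}

/-- The machine that executes the sampling program. -/
noncomputable def samplerNTM (M : NTM 1 0) (hbin : M.IsBinary) (l : List M.TapeIdx)
    (e : Fin a ⊕ Fin 2 ⊕ W ≃ Tp M.TapeIdx) (hW : Finite W) : NTM a 2 :=
  (sampler M hbin l).toNTM e hW (by have := M.finite_symb; infer_instance)
    ⟨Sum.inl, Sum.inl_injective⟩

theorem showsWord_of_eq {N : NTM a 2} {h : ℤ} {z : ℤ → Option N.Symb} {w : List Bool}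
    (hz : (⟨h, z⟩ : Tape N.Symb) = zip 0 [] ((w.map N.bit).map some)) : N.ShowsWord z w := by
  obtain rfl := congrArg Tape.cell hz
  exact ⟨fun j hj => by simp [zip, hj], by simp [zip]⟩

/-- The sampling machine estimates `f x / 2 ^ m`. Its error is relative to the number of
nondeterministic bits, although this number is not known to the machine: all samples lie between
`0` and `2 ^ M.ndBits ![x]`. -/
theorem estimates_samplerNTM (hbin : M.IsBinary) {l : List M.TapeIdx} (hl : ∀ i, i ∈ l)
    {e : Fin a ⊕ Fin 2 ⊕ W ≃ Tp M.TapeIdx} {hW : Finite W}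
    (hnum : e (.inr (.inl 0)) = .num) (hden : e (.inr (.inl 1)) = .den)
    {inp : Fin a → List Bool} {x : List Bool} {k d m P t : ℕ} {ξ δ : ℝ}
    (hinp : confOf e ((samplerNTM M hbin l e hW).init inp) = samplerInit M x k d m)
    (hP : HaltsFrom M (M.init ![x]) P) (hf : M.numPaths ![x] = f x + 1) (hξ : 0 < ξ) (hδ : 0 < δ)
    (hk : 1 / ξ ≤ k) (hd : Real.logb 2 (1 / δ) ≤ d)
    (ht : samplerCost k d (roundCost l.length x.length P m) ≤ t) :
    (samplerNTM M hbin l e hW).Estimates inp t (f x / 2 ^ m)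
      (ξ * 2 ^ M.ndBits ![x] / 2 ^ m) δ := by
  have hk0 : 0 < k := by
    have := (one_div_pos.2 hξ).trans_le hk
    exact_mod_cast this
  set R := k * (k * (1 + d)) with hR
  have hR0 : 0 < R := by positivity
  have main := Prog.Wp.toNTM (e := e) (hW := hW) (hΓ := by have := M.finite_symb; infer_instance)
    (bit := ⟨Sum.inl, Sum.inl_injective⟩)
    (Q := fun T S => ∃ b, Account x m S R b T) (fun T t μ h => by
      obtain ⟨S, b, h1, h2⟩ := h
      exact ⟨S, h1, b, h2⟩) ((wp_sampler (m := m) hbin hl hP k d).mono ht)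
    ((samplerNTM M hbin l e hW).init inp) rfl hinp
  refine ⟨main.1, ?_⟩
  refine (accuracy (two_pow_sub_one_mem hbin hP) (by positivity) (integral_sample hbin hP hf) hξ hδ
    hk hd hR).trans ((main.2 _).trans (measure_mono ?_))
  rintro c ⟨hc, S, hS, b, u, v, hh, hu, hv, -⟩
  have h0 := hh.num
  have h1 := hh.den
  rw [confOf, e.symm_apply_eq.2 hnum.symm] at h0
  rw [confOf, e.symm_apply_eq.2 hden.symm] at h1
  refine ⟨(S : ℚ) / ((R * 2 ^ m : ℕ) : ℚ), ⟨hc, u, v, ?_, ?_, ?_, ?_⟩, ?_⟩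
  · exact showsWord_of_eq (N := samplerNTM M hbin l e hW) h0
  · exact showsWord_of_eq (N := samplerNTM M hbin l e hW) h1
  · rw [hv]
    positivity
  · rw [hu, hv]
  · have hS' : |(S : ℝ) / R - f x| ≤ ξ * 2 ^ M.ndBits ![x] := hS
    have : (((S : ℚ) / ((R * 2 ^ m : ℕ) : ℚ) : ℚ) : ℝ) - f x / 2 ^ m =
        ((S : ℝ) / R - f x) / 2 ^ m := by
      push_cast
      field_simp
    rw [this, abs_div, abs_of_pos (by positivity : (0 : ℝ) < 2 ^ m)]
    gcongr

/-- The tapes of the sampling machine with four inputs. -/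
def tapesFour (τ : Type) : Fin 4 ⊕ Fin 2 ⊕ (τ ⊕ Fin 2) ≃ Tp τ where
  toFun
    | .inl 0 => .input
    | .inl 1 => .ctr 2
    | .inl 2 => .ctr 0
    | .inl 3 => .scale
    | .inr (.inl 0) => .num
    | .inr (.inl 1) => .den
    | .inr (.inr (.inl i)) => .sim i
    | .inr (.inr (.inr 0)) => .ctr 1
    | .inr (.inr (.inr 1)) => .depth
  invFun
    | .input => .inl 0
    | .ctr 2 => .inl 1
    | .ctr 0 => .inl 2
    | .scale => .inl 3
    | .num => .inr (.inl 0)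
    | .den => .inr (.inl 1)
    | .sim i => .inr (.inr (.inl i))
    | .ctr 1 => .inr (.inr (.inr 0))
    | .depth => .inr (.inr (.inr 1))
  left_inv := by
    rintro (i | i | i | i)
    · fin_cases i <;> rfl
    · fin_cases i <;> rfl
    · rfl
    · fin_cases i <;> rfl
  right_inv := by
    rintro (_ | _ | _ | _ | _ | i | i)
    all_goals first | rfl | (fin_cases i <;> rfl)

/-- The tapes of the sampling machine with three inputs, where the tape `scale` stays empty. -/
def tapesThree (τ : Type) : Fin 3 ⊕ Fin 2 ⊕ (τ ⊕ Fin 3) ≃ Tp τ where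
  toFun
    | .inl 0 => .input
    | .inl 1 => .ctr 2
    | .inl 2 => .ctr 0
    | .inr (.inl 0) => .num
    | .inr (.inl 1) => .den
    | .inr (.inr (.inl i)) => .sim i
    | .inr (.inr (.inr 0)) => .ctr 1
    | .inr (.inr (.inr 1)) => .depth
    | .inr (.inr (.inr 2)) => .scale
  invFun
    | .input => .inl 0
    | .ctr 2 => .inl 1
    | .ctr 0 => .inl 2
    | .num => .inr (.inl 0)
    | .den => .inr (.inl 1)
    | .sim i => .inr (.inr (.inl i))
    | .ctr 1 => .inr (.inr (.inr 0))
    | .depth => .inr (.inr (.inr 1))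
    | .scale => .inr (.inr (.inr 2))
  left_inv := by
    rintro (i | i | i | i)
    · fin_cases i <;> rfl
    · fin_cases i <;> rfl
    · rfl
    · fin_cases i <;> rfl
  right_inv := by
    rintro (_ | _ | _ | _ | _ | i | i)
    all_goals first | rfl | (fin_cases i <;> rfl)

theorem mk_none : (⟨0, fun _ => none⟩ : Tape (Alph M)) = wordTape M [] := by simp [zip]

theorem confOf_init_four (hbin : M.IsBinary) (l : List M.TapeIdx) (hW : Finite (M.TapeIdx ⊕ Fin 2))
    (x : List Bool) (k d m : ℕ) :
    confOf (tapesFour M.TapeIdx) ((samplerNTM M hbin l (tapesFour M.TapeIdx) hW).init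
      ![x, unary k, unary d, unary m]) = samplerInit M x k d m := by
  have key := mk_writeWord (samplerNTM M hbin l (tapesFour M.TapeIdx) hW)
  funext i
  rcases i with _ | _ | _ | _ | _ | i | i
  · exact key x
  · exact key (unary m)
  · exact mk_none
  · exact mk_none
  · exact mk_none
  · fin_cases i
    · exact key (unary d)
    · exact mk_none
    · exact key (unary k)
  · exact mk_none

theorem confOf_init_three (hbin : M.IsBinary) (l : List M.TapeIdx)
    (hW : Finite (M.TapeIdx ⊕ Fin 3)) (x : List Bool) (k d : ℕ) :
    confOf (tapesThree M.TapeIdx) ((samplerNTM M hbin l (tapesThree M.TapeIdx) hW).init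
      ![x, unary k, unary d]) = samplerInit M x k d 0 := by
  have key := mk_writeWord (samplerNTM M hbin l (tapesThree M.TapeIdx) hW)
  funext i
  rcases i with _ | _ | _ | _ | _ | i | i
  · exact key x
  · exact mk_none
  · exact mk_none
  · exact mk_none
  · exact mk_none
  · fin_cases i
    · exact key (unary d)
    · exact mk_none
    · exact key (unary k)
  · exact mk_none

end final

end TotPSampling

open TotPSampling in
theorem mainTheorem1 (f : List Bool → ℕ) (hf : f ∈ TotP)
    (M : NTM 1 0) (hbin : M.IsBinary) (hM : M.TotComputes f) :
    (∃ (A : NTM 3 2) (q : Polynomial ℕ), A.IsBinary ∧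
      ∀ (x : List Bool) (ξ δ : ℝ), 0 < ξ → 0 < δ →
        A.Estimates ![x, unary ⌈1 / ξ⌉₊, unary ⌈Real.logb 2 (1 / δ)⌉₊]
          (⌈1 / ξ⌉₊ ^ 2 * q.eval (x.length + ⌈Real.logb 2 (1 / δ)⌉₊))
          (f x) (ξ * 2 ^ M.ndBits ![x]) δ) ∧
    (∃ (B : NTM 4 2) (q : Polynomial ℕ), B.IsBinary ∧
      ∀ (x : List Bool) (m : ℕ) (ξ δ : ℝ), M.ndBits ![x] ≤ m → 0 < ξ → 0 < δ →
        B.Estimates ![x, unary ⌈1 / ξ⌉₊, unary ⌈Real.logb 2 (1 / δ)⌉₊, unary m]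
          (⌈1 / ξ⌉₊ ^ 2 * q.eval (x.length + ⌈Real.logb 2 (1 / δ)⌉₊ + m))
          (f x / 2 ^ m) ξ δ) := by
  obtain ⟨⟨p, hp⟩, hpaths⟩ := hM
  have := M.finite_work
  obtain ⟨l, hl⟩ : ∃ l : List M.TapeIdx, ∀ i, i ∈ l := by
    have := Fintype.ofFinite M.TapeIdx
    exact ⟨Finset.univ.toList, by simp⟩
  obtain ⟨q, hq⟩ := samplerCost_le p l.length
  have hk : ∀ ξ : ℝ, 0 < ξ → 1 ≤ ⌈1 / ξ⌉₊ := fun ξ hξ => Nat.ceil_pos.2 (one_div_pos.2 hξ)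
  refine ⟨⟨samplerNTM M hbin l (tapesThree _) inferInstance, q, isBinary_toNTM, ?_⟩,
    ⟨samplerNTM M hbin l (tapesFour _) inferInstance, q, isBinary_toNTM, ?_⟩⟩
  · intro x ξ δ hξ hδ
    have h := estimates_samplerNTM hbin hl rfl rfl (confOf_init_three hbin l inferInstance x _ _)
      (hp x) (hpaths x) hξ hδ (Nat.le_ceil _) (Nat.le_ceil _) (hq x.length _ _ 0 (hk ξ hξ))
    simpa using h
  · intro x m ξ δ hm hξ hδ
    obtain ⟨h1, h2⟩ := estimates_samplerNTM hbin hl rfl rfl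
      (confOf_init_four hbin l inferInstance x _ _ m)
      (hp x) (hpaths x) hξ hδ (Nat.le_ceil _) (Nat.le_ceil _) (hq x.length _ _ m (hk ξ hξ))
    refine ⟨h1, h2.trans (MeasureTheory.measure_mono ?_)⟩
    rintro c ⟨r, hr, herr⟩
    refine ⟨r, hr, herr.trans ?_⟩
    rw [div_le_iff₀ (by positivity)]
    gcongr
    norm_num
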